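/- Let $M$ be a smooth (Hausdorff, second countable, finite-dimensional) manifold, $\mathbb TM=TM\oplus T^*M$ with the inner product $\langle X+\alpha,Y+\beta\rangle=\frac12(\alpha(Y)+\beta(X))$. Let $\mathcal E_M$ be the algebra of $\mathbb R$-linear operators on the differential forms of $M$, with the graded commutator $[\psi,\chi]=\psi\chi-(-1)^{kl}\chi\psi$ for $\psi,\chi$ of degrees $k,l$; write $\mathrm{ad}_\psi=[\psi,\cdot]$. Functions act on forms by multiplication, and a section $X+\alpha$ of $\mathbb TM$ acts by $\omega\mapsto\iota_X\omega+\alpha\wedge\omega$. A generalized polynomial structure on $M$ is a smooth bundle endomorphism $\varphi$ of $\mathbb TM$, skew-symmetric with respect to $\langle\cdot,\cdot\rangle$, for which there is a monic polynomial $P\in\mathbb R[x]$ of positive degree that is the minimal polynomial of $\varphi_p:\mathbb T_pM\to\mathbb T_pM$ for every $p\in M$. Its lift $\widetilde\varphi$ is the unique even element of $\mathcal E_M$ such that $[\widetilde\varphi,f]=0$ for every smooth function $f$, $[\widetilde\varphi,\mathbf x]=\varphi(\mathbf x)$ for every section $\mathbf x$ of $\mathbb TM$, and $\widetilde\varphi(1)$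 is a $2$-form. Its minimal operator is $\delta_\varphi=P(\mathrm{ad}_{\widetilde\varphi})(d)$, where $d$ is the de Rham operator, and $\varphi$ is called minimal if its minimal torsion $\mathcal M_\varphi(\mathbf x,\mathbf y)=[[\mathbf x,\delta_\varphi],\mathbf y]$ vanishes for all sections $\mathbf x,\mathbf y$ of $\mathbb TM$. The semisimple part $\varphi_s$ and the nilpotent part $\varphi_n=\varphi-\varphi_s$ of $\varphi$ are given by the Jordan–Chevalley decomposition of $\varphi_p$ on each fibre $\mathbb T_pM$. **Proposition.** If $\varphi$ is a minimal generalized polynomial structure, then its semisimple part $\varphi_s$ and its nilpotent part $\varphi_n$ are both minimal generalized polynomial structures. -/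

import Mathlib

open scoped Manifold ContDiff Topology Bundle

noncomputable section

namespace GenGeom

/-! ### Multilinear algebra on a topological vector space -/

section Fibre

variable {V W : Type*} [AddCommGroup V] [Module ℝ V] [TopologicalSpace V]
  [AddCommGroup W] [Module ℝ W] [TopologicalSpace W]

/-- Interior product `ι_v θ = θ(v, ·, …, ·)`. -/
def contract {k : ℕ} (v : V) (θ : V [⋀^Fin (k + 1)]→L[ℝ] ℝ) : V [⋀^Fin k]→L[ℝ] ℝ :=
  { θ.toAlternatingMap.curryLeft v with
    cont := by
      change Continuous fun m : Fin k → V => θ (Matrix.vecCons v m)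
      exact θ.cont.comp (continuous_const.finCons continuous_id) }

@[simp] theorem contract_apply {k : ℕ} (v : V) (θ : V [⋀^Fin (k + 1)]→L[ℝ] ℝ) (m : Fin k → V) :
    contract v θ m = θ (Matrix.vecCons v m) := rfl

/-- Exterior product `α ∧ θ` of a covector with an alternating form:
`(α ∧ θ)(v₀, …, v_k) = ∑ i, (-1)^i α(v_i) θ(v₀, …, v̂_i, …, v_k)`. -/
def wedge {k : ℕ} (α : V →L[ℝ] ℝ) (θ : V [⋀^Fin k]→L[ℝ] ℝ) : V [⋀^Fin (k + 1)]→L[ℝ] ℝ :=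
  { AlternatingMap.alternatizeUncurryFin
      ((α : V →ₗ[ℝ] ℝ).smulRight θ.toAlternatingMap) with
    cont := by
      have h : (fun m : Fin (k + 1) → V => AlternatingMap.alternatizeUncurryFin
          ((α : V →ₗ[ℝ] ℝ).smulRight θ.toAlternatingMap) m) =
          fun m => ∑ i : Fin (k + 1), (-1 : ℝ) ^ (i : ℕ) * (α (m i) * θ (i.removeNth m)) := by
        funext m
        simp [AlternatingMap.alternatizeUncurryFin_apply]
      change Continuous fun m : Fin (k + 1) → V => AlternatingMap.alternatizeUncurryFin
          ((α : V →ₗ[ℝ] ℝ).smulRight θ.toAlternatingMap) m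
      rw [h]
      refine continuous_finsetSum _ fun i _ => continuous_const.mul ?_
      refine (α.continuous.comp (continuous_apply i)).mul (θ.cont.comp ?_)
      exact continuous_pi fun j => continuous_apply _ }

theorem wedge_apply {k : ℕ} (α : V →L[ℝ] ℝ) (θ : V [⋀^Fin k]→L[ℝ] ℝ) (m : Fin (k + 1) → V) :
    wedge α θ m = ∑ i : Fin (k + 1), (-1) ^ (i : ℕ) * (α (m i) * θ (i.removeNth m)) := by
  change AlternatingMap.alternatizeUncurryFin
          ((α : V →ₗ[ℝ] ℝ).smulRight θ.toAlternatingMap) m = _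
  simp [AlternatingMap.alternatizeUncurryFin_apply]

theorem contract_add {k : ℕ} (v : V) (θ η : V [⋀^Fin (k + 1)]→L[ℝ] ℝ) :
    contract v (θ + η) = contract v θ + contract v η := rfl

theorem contract_smul {k : ℕ} (v : V) (c : ℝ) (θ : V [⋀^Fin (k + 1)]→L[ℝ] ℝ) :
    contract v (c • θ) = c • contract v θ := rfl

theorem wedge_add {k : ℕ} (α : V →L[ℝ] ℝ) (θ η : V [⋀^Fin k]→L[ℝ] ℝ) :
    wedge α (θ + η) = wedge α θ + wedge α η := by
  ext m
  simp [wedge_apply, mul_add, Finset.sum_add_distrib]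

theorem wedge_smul {k : ℕ} (α : V →L[ℝ] ℝ) (c : ℝ) (θ : V [⋀^Fin k]→L[ℝ] ℝ) :
    wedge α (c • θ) = c • wedge α θ := by
  ext m
  simp only [wedge_apply, ContinuousAlternatingMap.smul_apply, smul_eq_mul, Finset.mul_sum]
  exact Finset.sum_congr rfl fun i _ => by ring

theorem contract_comp {k : ℕ} (A : W →L[ℝ] V) (w : W) (θ : V [⋀^Fin (k + 1)]→L[ℝ] ℝ) :
    (contract (A w) θ).compContinuousLinearMap A =
      contract w (θ.compContinuousLinearMap A) := by
  ext m
  simp only [ContinuousAlternatingMap.compContinuousLinearMap_apply, contract_apply]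
  congr 1
  funext i
  refine Fin.cases ?_ (fun j => ?_) i <;> simp

theorem wedge_comp {k : ℕ} (A : W →L[ℝ] V) (α : V →L[ℝ] ℝ) (θ : V [⋀^Fin k]→L[ℝ] ℝ) :
    (wedge α θ).compContinuousLinearMap A =
      wedge (α.comp A) (θ.compContinuousLinearMap A) := by
  ext m
  simp only [ContinuousAlternatingMap.compContinuousLinearMap_apply, wedge_apply]
  rfl

end Fibre

/-! ### Jordan–Chevalley decomposition of a linear endomorphism -/

section JordanChevalley

variable {V : Type*} [AddCommGroup V] [Module ℝ V] [FiniteDimensional ℝ V]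

/-- The semisimple part of an endomorphism. -/
def semisimplePart (f : Module.End ℝ V) : Module.End ℝ V :=
  f.exists_isNilpotent_isSemisimple.choose_spec.2.choose

/-- The nilpotent part of an endomorphism. -/
def nilpotentPart (f : Module.End ℝ V) : Module.End ℝ V := f - semisimplePart f

theorem semisimplePart_spec (f : Module.End ℝ V) :
    semisimplePart f ∈ Algebra.adjoin ℝ {f} ∧ nilpotentPart f ∈ Algebra.adjoin ℝ {f} ∧
      (semisimplePart f).IsSemisimple ∧ IsNilpotent (nilpotentPart f) ∧
      f = semisimplePart f + nilpotentPart f := by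
  have h1 := f.exists_isNilpotent_isSemisimple.choose_spec.1
  obtain ⟨h2, h3, h4, h5⟩ := f.exists_isNilpotent_isSemisimple.choose_spec.2.choose_spec
  have h6 : nilpotentPart f = f.exists_isNilpotent_isSemisimple.choose :=
    sub_eq_of_eq_add h5
  refine ⟨h2, h6 ▸ h1, h4, h6 ▸ h3, (add_sub_cancel _ _).symm⟩

end JordanChevalley

/-! ### Differential forms on a manifold -/

section Manifold

variable (E : Type*) [NormedAddCommGroup E] [NormedSpace ℝ E]
  (M : Type*) [TopologicalSpace M] [ChartedSpace E M] [IsManifold 𝓘(ℝ, E) ∞ M]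

variable {M} in
/-- The fibre at `p` of the generalized tangent bundle `TM ⊕ T*M`. -/
abbrev GenTangent (p : M) : Type _ :=
  TangentSpace 𝓘(ℝ, E) p × (TangentSpace 𝓘(ℝ, E) p →L[ℝ] ℝ)

instance finiteDimensional_tangentSpace [FiniteDimensional ℝ E] (p : M) :
    FiniteDimensional ℝ (TangentSpace 𝓘(ℝ, E) p) :=
  inferInstanceAs (FiniteDimensional ℝ E)

instance finiteDimensional_cotangentSpace [FiniteDimensional ℝ E] (p : M) :
    FiniteDimensional ℝ (TangentSpace 𝓘(ℝ, E) p →L[ℝ] ℝ) :=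
  inferInstanceAs (FiniteDimensional ℝ (E →L[ℝ] ℝ))

variable {M} in
/-- The frame map `E → T_p M` of the chart at `c` (the differential at `p` of the inverse chart). -/
abbrev frame (c p : M) : E →L[ℝ] TangentSpace 𝓘(ℝ, E) p :=
  (trivializationAt E (TangentSpace 𝓘(ℝ, E)) c).symmL ℝ p

variable {M} in
/-- The coframe map `T_p M → E` of the chart at `c` (the differential at `p` of the chart). -/
abbrev coframe (c p : M) : TangentSpace 𝓘(ℝ, E) p →L[ℝ] E :=
  (trivializationAt E (TangentSpace 𝓘(ℝ, E)) c).continuousLinearMapAt ℝ p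

variable {M} {E}

/-- Coordinate expression, in the chart at `c`, of a field of alternating `k`-forms: its pullback
along the inverse of the chart. -/
def formInChart {k : ℕ} (θ : ∀ p : M, TangentSpace 𝓘(ℝ, E) p [⋀^Fin k]→L[ℝ] ℝ) (c : M) (y : E) :
    E [⋀^Fin k]→L[ℝ] ℝ :=
  (θ ((extChartAt 𝓘(ℝ, E) c).symm y)).compContinuousLinearMap
    (frame E c ((extChartAt 𝓘(ℝ, E) c).symm y))

/-- Coordinate expression, in the chart at `c`, of a field of covectors. -/
def covectorInChart (α : ∀ p : M, TangentSpace 𝓘(ℝ, E) p →L[ℝ] ℝ) (c : M) (y : E) :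
    E →L[ℝ] ℝ :=
  (α ((extChartAt 𝓘(ℝ, E) c).symm y)).comp (frame E c ((extChartAt 𝓘(ℝ, E) c).symm y))

variable (E) (M)

/-- Smooth differential `k`-forms on `M`. -/
def SmoothForm (k : ℕ) : Submodule ℝ (∀ p : M, TangentSpace 𝓘(ℝ, E) p [⋀^Fin k]→L[ℝ] ℝ) where
  carrier := {θ | ∀ c : M, ContDiffOn ℝ ∞ (formInChart θ c) (extChartAt 𝓘(ℝ, E) c).target}
  add_mem' h h' c := (h c).add (h' c)
  zero_mem' _ := contDiffOn_const (c := 0)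
  smul_mem' r _ h c := contDiffOn_const.smul (h c) (f := fun _ => r)

/-- The space `Ω(M)` of smooth differential forms of arbitrary degree. (Forms of degree larger than
the dimension vanish, so the product over all degrees is the direct sum.) -/
def Forms : Type _ := ∀ k : ℕ, SmoothForm E M k

instance : AddCommGroup (Forms E M) := inferInstanceAs (AddCommGroup (∀ k : ℕ, SmoothForm E M k))

instance : Module ℝ (Forms E M) := inferInstanceAs (Module ℝ (∀ k : ℕ, SmoothForm E M k))

/-- The algebra of `ℝ`-linear operators on differential forms. -/
abbrev Operator : Type _ := Module.End ℝ (Forms E M)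

/-- Smooth sections `X + α` of the generalized tangent bundle `TM ⊕ T*M`. -/
structure GenSection where
  /-- the values of the section -/
  toFun : ∀ p : M, GenTangent E p
  smooth_vector : ContMDiff 𝓘(ℝ, E) (𝓘(ℝ, E).prod 𝓘(ℝ, E)) ∞
    (fun p => (⟨p, (toFun p).1⟩ : TangentBundle 𝓘(ℝ, E) M))
  smooth_covector : ∀ c : M,
    ContDiffOn ℝ ∞ (covectorInChart (fun p => (toFun p).2) c) (extChartAt 𝓘(ℝ, E) c).target

variable {E} {M}

theorem extChartAt_symm_mem {c : M} {y : E} (hy : y ∈ (extChartAt 𝓘(ℝ, E) c).target) :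
    (extChartAt 𝓘(ℝ, E) c).symm y ∈ (chartAt E c).source := by
  rw [← extChartAt_source 𝓘(ℝ, E)]
  exact (extChartAt 𝓘(ℝ, E) c).map_target hy

theorem frame_coframe {c p : M} (hp : p ∈ (chartAt E c).source) (v : TangentSpace 𝓘(ℝ, E) p) :
    frame E c p (coframe E c p v) = v :=
  Bundle.Trivialization.symmL_continuousLinearMapAt _ (by simpa using hp) v

theorem coframe_frame {c p : M} (hp : p ∈ (chartAt E c).source) (v : E) :
    coframe E c p (frame E c p v) = v :=
  Bundle.Trivialization.continuousLinearMapAt_symmL _ (by simpa using hp) v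

/-- The coordinate expression of a smooth vector field is smooth. -/
theorem vectorInChart_smooth (x : GenSection E M) (c : M) :
    ContDiffOn ℝ ∞ (fun y => coframe E c ((extChartAt 𝓘(ℝ, E) c).symm y)
      (x.toFun ((extChartAt 𝓘(ℝ, E) c).symm y)).1) (extChartAt 𝓘(ℝ, E) c).target := by
  have h1 := (Bundle.Trivialization.contMDiffOn_section_baseSet_iff (n := ∞) (IB := 𝓘(ℝ, E))
    (trivializationAt E (TangentSpace 𝓘(ℝ, E)) c)).1 x.smooth_vector.contMDiffOn
  have h2 := h1.comp (contMDiffOn_extChartAt_symm (I := 𝓘(ℝ, E)) (n := ∞) c)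
    (fun y hy => by simpa using extChartAt_symm_mem hy)
  refine (contMDiffOn_iff_contDiffOn.1 h2).congr fun y hy => ?_
  have hb : (extChartAt 𝓘(ℝ, E) c).symm y ∈
      (trivializationAt E (TangentSpace 𝓘(ℝ, E)) c).baseSet := by
    simpa using extChartAt_symm_mem hy
  simp only [Function.comp_apply]
  change coframe E c _ _ = _
  unfold coframe
  rw [Bundle.Trivialization.continuousLinearMapAt_apply, Bundle.Trivialization.coe_linearMapAt_of_mem _ hb]

/-- The interior product with a vector field preserves smoothness. -/
theorem contract_smooth (x : GenSection E M) {k : ℕ} (θ : SmoothForm E M (k + 1)) :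
    (fun p => contract (x.toFun p).1 (θ.1 p)) ∈ SmoothForm E M k := by
  intro c
  have h := ((ContinuousAlternatingMap.curryLeftLI (𝕜 := ℝ) (E := E) (F := ℝ)
    (n := k)).toContinuousLinearMap.contDiff.comp_contDiffOn (θ.2 c)).clm_apply
      (vectorInChart_smooth x c)
  refine h.congr fun y hy => ?_
  have hv := frame_coframe (extChartAt_symm_mem hy)
    (x.toFun ((extChartAt 𝓘(ℝ, E) c).symm y)).1
  change (contract (x.toFun ((extChartAt 𝓘(ℝ, E) c).symm y)).1 _).compContinuousLinearMap _ = _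
  rw [← hv, contract_comp, hv]
  rfl

/-- The exterior product with a 1-form preserves smoothness. -/
theorem wedge_smooth (x : GenSection E M) {k : ℕ} (θ : SmoothForm E M k) :
    (fun p => wedge (x.toFun p).2 (θ.1 p)) ∈ SmoothForm E M (k + 1) := by
  intro c
  have h := (ContinuousAlternatingMap.alternatizeUncurryFinCLM ℝ E ℝ).contDiff.comp_contDiffOn
    ((x.smooth_covector c).smulRight (θ.2 c))
  refine h.congr fun y hy => ?_
  unfold formInChart
  rw [wedge_comp]
  ext m
  simp [wedge_apply, ContinuousAlternatingMap.alternatizeUncurryFin_apply,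
    covectorInChart]

/-- The interior product operator `ι_X` of a section `X + α` of `TM ⊕ T*M`. -/
def contractOp (x : GenSection E M) : Operator E M where
  toFun θ k := ⟨fun p => contract (x.toFun p).1 ((θ (k + 1)).1 p), contract_smooth x (θ (k + 1))⟩
  map_add' _ _ := rfl
  map_smul' _ _ := rfl

/-- The exterior product operator `α ∧ ·` of a section `X + α` of `TM ⊕ T*M`. -/
def wedgeOp (x : GenSection E M) : Operator E M where
  toFun θ
    | 0 => 0
    | k + 1 => ⟨fun p => wedge (x.toFun p).2 ((θ k).1 p), wedge_smooth x (θ k)⟩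
  map_add' θ η := by
    funext k
    cases k with
    | zero => exact (add_zero _).symm
    | succ k =>
      apply Subtype.ext; funext p
      exact wedge_add _ ((θ k).1 p) ((η k).1 p)
  map_smul' r θ := by
    funext k
    cases k with
    | zero => exact (smul_zero r).symm
    | succ k =>
      apply Subtype.ext; funext p
      exact wedge_smul _ r ((θ k).1 p)

/-- The action of a section `X + α` of `TM ⊕ T*M` on forms: `θ ↦ ι_X θ + α ∧ θ`. -/
def clifford (x : GenSection E M) : Operator E M := contractOp x + wedgeOp x

/-- Multiplication of forms by a smooth function. -/
theorem smul_smooth (f : C^∞⟮𝓘(ℝ, E), M; 𝓘(ℝ, ℝ), ℝ⟯) {k : ℕ} (θ : SmoothForm E M k) :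
    (fun p => f p • θ.1 p) ∈ SmoothForm E M k := by
  intro c
  have h2 := f.contMDiff.comp_contMDiffOn (contMDiffOn_extChartAt_symm (I := 𝓘(ℝ, E)) (n := ∞) c)
  exact (contMDiffOn_iff_contDiffOn.1 h2).smul (θ.2 c)

/-- The operator of multiplication by a smooth function. -/
def mulFun (f : C^∞⟮𝓘(ℝ, E), M; 𝓘(ℝ, ℝ), ℝ⟯) : Operator E M where
  toFun θ k := ⟨fun p => f p • (θ k).1 p, smul_smooth f (θ k)⟩
  map_add' θ η := by
    funext k; apply Subtype.ext; funext p; exact smul_add _ _ _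
  map_smul' r θ := by
    funext k; apply Subtype.ext; funext p; exact smul_comm (f p) r ((θ k).1 p)

/-- The exterior derivative of a `k`-form: at `p`, the exterior derivative of its coordinate
expression in the chart at `p`, carried back to `T_p M`. -/
def extDerivAt {k : ℕ} (θ : ∀ p : M, TangentSpace 𝓘(ℝ, E) p [⋀^Fin k]→L[ℝ] ℝ) (p : M) :
    TangentSpace 𝓘(ℝ, E) p [⋀^Fin (k + 1)]→L[ℝ] ℝ :=
  (extDeriv (formInChart θ p) (extChartAt 𝓘(ℝ, E) p p)).compContinuousLinearMap (coframe E p p)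

/-- The exterior derivative may be computed in any chart. -/
theorem formInChart_extDerivAt {k : ℕ} (θ : SmoothForm E M k) (c : M) {y : E}
    (hy : y ∈ (extChartAt 𝓘(ℝ, E) c).target) :
    formInChart (extDerivAt θ.1) c y = extDeriv (formInChart θ.1 c) y := by
  set p := (extChartAt 𝓘(ℝ, E) c).symm y with hp
  have hpc : p ∈ (extChartAt 𝓘(ℝ, E) c).source := (extChartAt 𝓘(ℝ, E) c).map_target hy
  have hpp : p ∈ (extChartAt 𝓘(ℝ, E) p).source := mem_extChartAt_source p
  have hyp : extChartAt 𝓘(ℝ, E) c p = y := (extChartAt 𝓘(ℝ, E) c).right_inv hy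
  set ψ : E → E := extChartAt 𝓘(ℝ, E) p ∘ (extChartAt 𝓘(ℝ, E) c).symm with hψ
  have hψy : ψ y = extChartAt 𝓘(ℝ, E) p p := rfl
  -- the differential of the transition map
  have key : ∀ q : M, q ∈ (extChartAt 𝓘(ℝ, E) c).source → q ∈ (extChartAt 𝓘(ℝ, E) p).source →
      (coframe E p q).comp (frame E c q) = fderiv ℝ ψ (extChartAt 𝓘(ℝ, E) c q) := by
    intro q hqc hqp
    have h1 := hasFDerivWithinAt_tangentCoordChange (I := 𝓘(ℝ, E)) (x := c) (y := p) (z := q)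
      ⟨hqc, hqp⟩
    have h2 : HasFDerivAt ψ (tangentCoordChange 𝓘(ℝ, E) c p q) (extChartAt 𝓘(ℝ, E) c q) := by
      rw [modelWithCornersSelf_coe, Set.range_id, hasFDerivWithinAt_univ] at h1
      exact h1
    rw [h2.fderiv]
    rw [extChartAt_source] at hqc hqp
    ext v
    have h3 := TangentBundle.symmL_trivializationAt_eq_core (I := 𝓘(ℝ, E)) hqc
    have h4 := TangentBundle.continuousLinearMapAt_trivializationAt_eq_core (I := 𝓘(ℝ, E)) hqp
    change coframe E p q (frame E c q v) = _
    unfold coframe frame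
    rw [h3, h4]
    refine tangentCoordChange_comp (I := 𝓘(ℝ, E)) (w := c) (x := q) (y := p) (z := q) ?_
    simp only [extChartAt_source]
    exact ⟨⟨hqc, mem_chart_source E q⟩, hqp⟩
  -- the coordinate expressions in the two charts agree near `y`
  have hev : formInChart θ.1 c =ᶠ[𝓝 y]
      fun z => (formInChart θ.1 p (ψ z)).compContinuousLinearMap (fderiv ℝ ψ z) := by
    have ht : (extChartAt 𝓘(ℝ, E) c).target ∈ 𝓝 y :=
      (isOpen_extChartAt_target c).mem_nhds hy
    have hs : (extChartAt 𝓘(ℝ, E) c).symm ⁻¹' (extChartAt 𝓘(ℝ, E) p).source ∈ 𝓝 y :=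
      ((continuousOn_extChartAt_symm c).continuousAt ht).preimage_mem_nhds
        ((isOpen_extChartAt_source p).mem_nhds hpp)
    filter_upwards [ht, hs] with z hz hzs
    have hzc := (extChartAt 𝓘(ℝ, E) c).map_target hz
    have hz1 := key _ hzc hzs
    rw [(extChartAt 𝓘(ℝ, E) c).right_inv hz] at hz1
    rw [← hz1]
    have hinv : (extChartAt 𝓘(ℝ, E) p).symm (ψ z) = (extChartAt 𝓘(ℝ, E) c).symm z :=
      (extChartAt 𝓘(ℝ, E) p).left_inv hzs
    unfold formInChart
    rw [hinv]
    ext m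
    simp only [ContinuousAlternatingMap.compContinuousLinearMap_apply]
    congr 1
    funext i
    exact (frame_coframe (by rwa [extChartAt_source] at hzs) _).symm
  have hψs : ContDiffAt ℝ ∞ ψ y := by
    have h := contDiffWithinAt_ext_coord_change (I := 𝓘(ℝ, E)) (n := ∞) p c (y := y) (by
      rw [PartialEquiv.trans_source'', PartialEquiv.symm_symm, PartialEquiv.symm_target]
      exact ⟨p, ⟨hpc, hpp⟩, hyp⟩)
    rw [modelWithCornersSelf_coe, Set.range_id, contDiffWithinAt_univ] at h
    exact h
  have hθ : DifferentiableAt ℝ (formInChart θ.1 p) (ψ y) :=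
    ((θ.2 p).contDiffAt ((isOpen_extChartAt_target p).mem_nhds
      ((extChartAt 𝓘(ℝ, E) p).map_source hpp))).differentiableAt (by simp)
  have hpull := extDeriv_pullback hθ hψs (by
    rw [minSmoothness_of_isRCLikeNormedField]; exact ENat.LEInfty.out)
  have hR : extDeriv (formInChart θ.1 c) y =
      (extDeriv (formInChart θ.1 p) (ψ y)).compContinuousLinearMap (fderiv ℝ ψ y) := by
    rw [← hpull]
    unfold extDeriv
    rw [hev.fderiv_eq]
  rw [hR]
  have hk := key p hpc hpp
  rw [hyp] at hk
  rw [← hk]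
  rfl

theorem extDerivAt_smooth {k : ℕ} (θ : SmoothForm E M k) :
    extDerivAt θ.1 ∈ SmoothForm E M (k + 1) := by
  intro c
  have ho : IsOpen (extChartAt 𝓘(ℝ, E) c).target := isOpen_extChartAt_target c
  refine ContDiffOn.congr ?_ fun y hy => formInChart_extDerivAt θ c hy
  exact (ContinuousAlternatingMap.alternatizeUncurryFinCLM ℝ E ℝ).contDiff.comp_contDiffOn
    ((θ.2 c).fderiv_of_isOpen ho (m := ∞) le_rfl)

theorem formInChart_differentiableAt {k : ℕ} (θ : SmoothForm E M k) (p : M) :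
    DifferentiableAt ℝ (formInChart θ.1 p) (extChartAt 𝓘(ℝ, E) p p) :=
  ((θ.2 p).contDiffAt ((isOpen_extChartAt_target p).mem_nhds
    (mem_extChartAt_target p))).differentiableAt (by simp)

theorem extDerivAt_add {k : ℕ} (θ η : SmoothForm E M k) :
    extDerivAt (θ + η).1 = extDerivAt θ.1 + extDerivAt η.1 := by
  funext p
  unfold extDerivAt
  rw [show formInChart (θ + η).1 p = formInChart θ.1 p + formInChart η.1 p from rfl,
    extDeriv_add (formInChart_differentiableAt θ p) (formInChart_differentiableAt η p)]
  rfl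

theorem extDerivAt_smul {k : ℕ} (r : ℝ) (θ : SmoothForm E M k) :
    extDerivAt (r • θ).1 = r • extDerivAt θ.1 := by
  funext p
  unfold extDerivAt
  rw [show formInChart (r • θ).1 p = r • formInChart θ.1 p from rfl, extDeriv_smul]
  rfl

variable (E M)

/-- The de Rham operator `d`. -/
def deRham : Operator E M where
  toFun θ
    | 0 => 0
    | k + 1 => ⟨extDerivAt (θ k).1, extDerivAt_smooth (θ k)⟩
  map_add' θ η := by
    funext k
    cases k with
    | zero => exact (add_zero _).symm
    | succ k => exact Subtype.ext (extDerivAt_add (θ k) (η k))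
  map_smul' r θ := by
    funext k
    cases k with
    | zero => exact (smul_zero r).symm
    | succ k => exact Subtype.ext (extDerivAt_smul r (θ k))

/-- The constant function `1`, as a differential form of degree `0`. -/
def oneForm : Forms E M
  | 0 => ⟨fun _ => ContinuousAlternatingMap.constOfIsEmpty ℝ _ (Fin 0) 1, fun _ =>
      contDiffOn_const (c := ContinuousAlternatingMap.constOfIsEmpty ℝ E (Fin 0) (1 : ℝ))⟩
  | _ + 1 => 0

/-! ### Graded commutators and derived brackets -/

/-- The parity operator, `(-1)^k` on `k`-forms. -/
def parity : Operator E M where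
  toFun θ k := (-1 : ℝ) ^ k • θ k
  map_add' _ _ := by funext k; exact smul_add _ _ _
  map_smul' r θ := by funext k; exact smul_comm _ r (θ k)

variable {E M}

/-- Conjugation by the parity operator: `1` on even operators and `-1` on odd ones. -/
def parityConj : Operator E M →ₗ[ℝ] Operator E M :=
  LinearMap.mulLeft ℝ (parity E M) ∘ₗ LinearMap.mulRight ℝ (parity E M)

/-- The component of even degree of an operator. -/
def evenPart (ψ : Operator E M) : Operator E M := (2⁻¹ : ℝ) • (ψ + parityConj ψ)

/-- The component of odd degree of an operator. -/
def oddPart (ψ : Operator E M) : Operator E M := (2⁻¹ : ℝ) • (ψ - parityConj ψ)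

/-- The adjoint action `ad_ψ = [ψ, ·]` for the graded commutator: the bilinear operation which is
`[ψ, χ] = ψχ - (-1)^{kl} χψ` for `ψ` of degree `k` and `χ` of degree `l`. -/
def ad (ψ : Operator E M) : Module.End ℝ (Operator E M) :=
  LinearMap.mulLeft ℝ ψ - LinearMap.mulRight ℝ (evenPart ψ) -
    LinearMap.mulRight ℝ (oddPart ψ) ∘ₗ parityConj

/-- The derived bracket `[[ψ, δ], χ]` associated with `ad_δ`. For `δ = d` it is the Dorfman
bracket. -/
def derivedBracket (δ ψ χ : Operator E M) : Operator E M := ad (ad ψ δ) χ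

/-! ### Generalized polynomial structures and minimality -/

variable (φ : ∀ p : M, Module.End ℝ (GenTangent E p))

/-- The tautological inner product `⟨X + α, Y + β⟩ = (α(Y) + β(X)) / 2`. -/
def tautInner {p : M} (x y : GenTangent E p) : ℝ := (x.2 y.1 + y.2 x.1) / 2

/-- A fibrewise linear field `φ` is a skew-symmetric endomorphism of `TM ⊕ T*M` if it maps smooth
sections to smooth sections and is skew for the tautological inner product. -/
structure IsSkewEndomorphism : Prop where
  smooth : ∀ x : GenSection E M, ∃ y : GenSection E M, ∀ p, y.toFun p = φ p (x.toFun p)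
  skew : ∀ (p : M) (x y : GenTangent E p), tautInner (φ p x) y + tautInner x (φ p y) = 0

/-- `φ` is a generalized polynomial structure with minimal polynomial `P`. -/
structure IsPolynomialStructure (P : Polynomial ℝ) : Prop extends IsSkewEndomorphism φ where
  monic : P.Monic
  natDegree_pos : 0 < P.natDegree
  minpoly_eq : ∀ p : M, minpoly ℝ (φ p) = P

/-- `Φ` is the lift of `φ` to the operators on forms: the even operator that commutes with
functions, satisfies `[Φ, x] = φ(x)` for all sections `x` of `TM ⊕ T*M`, and maps the function `1`
to a 2-form. -/
structure IsLift (Φ : Operator E M) : Prop where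
  even : parityConj Φ = Φ
  comm_fun : ∀ f : C^∞⟮𝓘(ℝ, E), M; 𝓘(ℝ, ℝ), ℝ⟯, ad Φ (mulFun f) = 0
  comm_section : ∀ x y : GenSection E M, (∀ p, y.toFun p = φ p (x.toFun p)) →
    ad Φ (clifford x) = clifford y
  apply_one : ∀ k : ℕ, k ≠ 2 → Φ (oneForm E M) k = 0

/-- The minimal operator `P(ad_Φ)(d)`. -/
def minimalOperator (P : Polynomial ℝ) (Φ : Operator E M) : Operator E M :=
  Polynomial.aeval (ad Φ) P (deRham E M)

/-- `φ` is a minimal generalized polynomial structure: it is a generalized polynomial structure,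
with minimal polynomial `P` and lift `Φ` to the operators on forms, and its minimal torsion, the
derived bracket of its minimal operator on sections of `TM ⊕ T*M`, vanishes. -/
def IsMinimal : Prop :=
  ∃ P : Polynomial ℝ, IsPolynomialStructure φ P ∧ ∃ Φ : Operator E M, IsLift φ Φ ∧
    ∀ x y : GenSection E M, derivedBracket (minimalOperator P Φ) (clifford x) (clifford y) = 0

end Manifold

end GenGeom

end

/-!
# Semisimple and nilpotent parts of minimal generalized polynomial structures

Let `δ` be an odd operator on forms, and let `T_δ(x, y, z) = [[[x, δ], y], z]` be its torsion, a
trilinear map on the sections of `TM ⊕ T*M` (`torsion`). If `[Φ, x] = a x` for all sections `x`,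
then by the Jacobi identity the torsion of `[Φ, δ]` is `[Φ, T_δ] - (a₁ + a₂ + a₃) T_δ`, where `aᵢ`
inserts `a` into the `i`-th argument. For `δ = d` the values of the torsion are multiplications by
functions, because the Dorfman bracket of two sections is again a section
(`exists_actsPointwise_dorfman`) and the anticommutator of two sections is a function. These values
commute with every lift, so the torsion of `P(ad_Φ) d` is `P(-(a₁ + a₂ + a₃)) T_d`
(`torsion_aeval`). Its vanishing is implied by the vanishing of the minimal torsion, and implies it:
the derived brackets of `P(ad_Φ) d` act pointwise through elements of `TM ⊕ T*M`, which are
determined by their pairings with sections (`derivedBracket_eq_zero_of_torsion_eq_zero`).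

What remains is commutative algebra. A polynomial `q` computes the semisimple part of every operator
annihilated by `P` (`IsJordanChevalleyPolynomial`). The operators `aᵢ` commute and are annihilated
by `P`, so they generate a finite-dimensional commutative algebra. Divided by the annihilator of
`T_d`, it is a finite-dimensional commutative algebra in which `-(a₁ + a₂ + a₃)` is annihilated by `P` as
well. Semisimple parts are additive there, so that `r(-(a₁ + a₂ + a₃))` equals
`-(r(a₁) + r(a₂) + r(a₃))` both for `r = q` and for `r = X - q`, and a polynomial `Q` with
`P ∣ Q ∘ r` annihilates it (`IsJordanChevalleyPolynomial.aeval_neg_add_apply`). With `Q` the minimal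
polynomial of `r(φ)`, this is the minimality of the semisimple and of the nilpotent part of `φ`.

Two facts make these parts generalized polynomial structures with a lift. As polynomials in `φ` with
constant coefficients they are smooth, and they are skew because `q(-φ)` is the semisimple part of
`-φ` (`IsJordanChevalleyPolynomial.skew`). The lift of a skew field `A` is the quadratic Clifford
element `½ ∑ᵢ (A eᵢ · ξᵢ + A ξᵢ · eᵢ)` up to a scalar (`fibreLift`), which does not depend on the
pair of dual bases, so that local frames show its smoothness (`liftAt_smooth`).
-/

noncomputable section

namespace GenGeom

/-! ### Jordan–Chevalley decomposition by universal polynomials -/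

section JordanChevalleyPolynomial

open Polynomial

variable {V : Type*} [AddCommGroup V] [Module ℝ V]

/-- Uniqueness of the Jordan–Chevalley decomposition. -/
theorem semisimplePart_eq_of_isSemisimple [FiniteDimensional ℝ V] {f s : Module.End ℝ V}
    (hs : s.IsSemisimple) (hn : IsNilpotent (f - s)) (hc : Commute f s) : semisimplePart f = s := by
  obtain ⟨h1, -, h3, h4, -⟩ := semisimplePart_spec f
  have hcs : Commute (semisimplePart f) s :=
    ((Algebra.commute_of_mem_adjoin_singleton_of_commute h1 hc.symm)).symm
  have hcf : Commute (semisimplePart f) f :=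
    (Algebra.commute_of_mem_adjoin_singleton_of_commute h1 (Commute.refl f)).symm
  refine sub_eq_zero.1 (Module.End.eq_zero_of_isNilpotent_isSemisimple ?_
    (h3.sub_of_commute hcs hs))
  have : semisimplePart f - s = (f - s) - nilpotentPart f := by
    rw [nilpotentPart]; abel
  rw [this]
  refine Commute.isNilpotent_sub ?_ hn h4
  rw [nilpotentPart]
  exact ((Commute.refl f).sub_left hc.symm).sub_right
    (hcf.symm.sub_left hcs.symm)

/-- The polynomial `q` computes semisimple parts modulo `P`: in `ℝ[x]/P` the class of `q` is
annihilated by a squarefree polynomial and `x - q` is nilpotent. Divisibility by `P` expresses this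
without the quotient ring. -/
def IsJordanChevalleyPolynomial (P q : ℝ[X]) : Prop :=
  (∃ R : ℝ[X], Squarefree R ∧ P ∣ R.comp q) ∧ ∃ m : ℕ, P ∣ (X - q) ^ m

theorem exists_isJordanChevalleyPolynomial [FiniteDimensional ℝ V] (f : Module.End ℝ V) :
    ∃ q, IsJordanChevalleyPolynomial (minpoly ℝ f) q := by
  obtain ⟨h1, -, h3, ⟨m, hm⟩, -⟩ := semisimplePart_spec f
  rw [Algebra.adjoin_singleton_eq_range_aeval] at h1
  obtain ⟨q, hq⟩ := h1
  replace hq : aeval f q = semisimplePart f := hq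
  refine ⟨q, ⟨minpoly ℝ (semisimplePart f), h3.minpoly_squarefree, minpoly.dvd _ _ ?_⟩,
    m, minpoly.dvd _ _ ?_⟩
  · rw [aeval_comp, hq, minpoly.aeval]
  · rw [map_pow, map_sub, aeval_X, hq]; exact hm

theorem aeval_eq_zero_of_dvd {A : Type*} [Ring A] [Algebra ℝ A] {P Q : ℝ[X]} (h : P ∣ Q) {a : A}
    (ha : aeval a P = 0) : aeval a Q = 0 := by
  obtain ⟨R, rfl⟩ := h
  rw [map_mul, ha, zero_mul]

theorem IsJordanChevalleyPolynomial.isSemisimple {P q : ℝ[X]}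
    (h : IsJordanChevalleyPolynomial P q) {g : Module.End ℝ V} (hg : aeval g P = 0) :
    (aeval g q).IsSemisimple := by
  obtain ⟨R, hR, hd⟩ := h.1
  refine Module.End.isSemisimple_of_squarefree_aeval_eq_zero hR ?_
  rw [← aeval_comp]
  exact aeval_eq_zero_of_dvd hd hg

theorem IsJordanChevalleyPolynomial.isNilpotent {A : Type*} [Ring A] [Algebra ℝ A] {P q : ℝ[X]}
    (h : IsJordanChevalleyPolynomial P q) {g : A} (hg : aeval g P = 0) :
    IsNilpotent (g - aeval g q) := by
  obtain ⟨m, hm⟩ := h.2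
  refine ⟨m, ?_⟩
  have := aeval_eq_zero_of_dvd hm hg
  rwa [map_pow, map_sub, aeval_X] at this

theorem IsJordanChevalleyPolynomial.semisimplePart_eq [FiniteDimensional ℝ V] {P q : ℝ[X]}
    (h : IsJordanChevalleyPolynomial P q) {g : Module.End ℝ V} (hg : aeval g P = 0) :
    semisimplePart g = aeval g q :=
  semisimplePart_eq_of_isSemisimple (h.isSemisimple hg) (h.isNilpotent hg)
    (by simpa using Commute.map ((Commute.all X q)) (aeval g))

/-- In a finite-dimensional commutative algebra, taking semisimple parts is additive: the difference
of the two sides is both nilpotent and a semisimple multiplication operator. -/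
theorem IsJordanChevalleyPolynomial.aeval_neg_add {C : Type*} [CommRing C] [Algebra ℝ C]
    [FiniteDimensional ℝ C] {P q : ℝ[X]} (h : IsJordanChevalleyPolynomial P q) {b₁ b₂ b₃ : C}
    (h₁ : aeval b₁ P = 0) (h₂ : aeval b₂ P = 0) (h₃ : aeval b₃ P = 0)
    (h₀ : aeval (-(b₁ + b₂ + b₃)) P = 0) :
    aeval (-(b₁ + b₂ + b₃)) q = -(aeval b₁ q + aeval b₂ q + aeval b₃ q) := by
  have hss : ∀ b : C, aeval b P = 0 → (Algebra.lmul ℝ C (aeval b q)).IsSemisimple := by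
    intro b hb
    rw [← Polynomial.aeval_algHom_apply]
    apply h.isSemisimple
    rw [Polynomial.aeval_algHom_apply, hb, map_zero]
  have hcomm : ∀ x y : C, Commute (Algebra.lmul ℝ C x) (Algebra.lmul ℝ C y) :=
    fun x y => (Commute.all x y).map _
  set x := aeval (-(b₁ + b₂ + b₃)) q + (aeval b₁ q + aeval b₂ q + aeval b₃ q) with hx
  have hs : (Algebra.lmul ℝ C x).IsSemisimple := by
    rw [hx, map_add, map_add, map_add]
    have h12 := (hss _ h₁).add_of_commute (hcomm _ _) (hss _ h₂)
    rw [← map_add] at h12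
    have h123 := h12.add_of_commute (hcomm _ _) (hss _ h₃)
    rw [← map_add] at h123
    rw [← map_add, ← map_add]
    exact (hss _ h₀).add_of_commute (hcomm _ _) h123
  have hn : IsNilpotent x := by
    have e : x = -((-(b₁ + b₂ + b₃) - aeval (-(b₁ + b₂ + b₃)) q) +
        ((b₁ - aeval b₁ q) + (b₂ - aeval b₂ q) + (b₃ - aeval b₃ q))) := by
      rw [hx]; ring
    have hadd : ∀ {x y : C}, IsNilpotent x → IsNilpotent y → IsNilpotent (x + y) :=
      fun {x y} hx hy => Commute.isNilpotent_add (Commute.all x y) hx hy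
    rw [e]
    exact (hadd (h.isNilpotent h₀) (hadd (hadd (h.isNilpotent h₁) (h.isNilpotent h₂))
      (h.isNilpotent h₃))).neg
  have h0 := Module.End.eq_zero_of_isNilpotent_isSemisimple (hn.map (Algebra.lmul ℝ C)) hs
  have hx0 : x = 0 := by
    have := LinearMap.congr_fun h0 1
    simpa using this
  exact eq_neg_of_add_eq_zero_left hx0

/-- A version of `IsJordanChevalleyPolynomial.aeval_neg_add` modulo an ideal, for the semisimple
part `q` and the nilpotent part `X - q` at once. -/
theorem IsJordanChevalleyPolynomial.aeval_neg_add_mem {A : Type*} [CommRing A] [Algebra ℝ A]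
    [Module.Finite ℝ A] {P q : ℝ[X]} (h : IsJordanChevalleyPolynomial P q) {g : Fin 3 → A}
    (hg : ∀ i, aeval (g i) P = 0) {I : Ideal A} (h₀ : aeval (-(g 0 + g 1 + g 2)) P ∈ I)
    {r Q : ℝ[X]} (hr : r = q ∨ r = X - q) (hQ : P ∣ Q.comp r) :
    aeval (-(aeval (g 0) r + aeval (g 1) r + aeval (g 2) r)) Q ∈ I := by
  let ρ : A →ₐ[ℝ] A ⧸ I := Ideal.Quotient.mkₐ ℝ I
  have hρ : ∀ x : A, ρ x = 0 ↔ x ∈ I := fun x => Ideal.Quotient.eq_zero_iff_mem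
  have hfinC : FiniteDimensional ℝ (A ⧸ I) :=
    Module.Finite.of_surjective ρ.toLinearMap Ideal.Quotient.mk_surjective
  have hb : ∀ i, aeval (ρ (g i)) P = 0 := fun i => by
    rw [Polynomial.aeval_algHom_apply, hg i, map_zero]
  have hb0 : aeval (-(ρ (g 0) + ρ (g 1) + ρ (g 2))) P = 0 := by
    rw [← map_add, ← map_add, ← map_neg, Polynomial.aeval_algHom_apply, hρ]
    exact h₀
  have key : aeval (-(ρ (g 0) + ρ (g 1) + ρ (g 2))) r =
      -(aeval (ρ (g 0)) r + aeval (ρ (g 1)) r + aeval (ρ (g 2)) r) := by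
    have hk := h.aeval_neg_add (hb 0) (hb 1) (hb 2) hb0
    rcases hr with rfl | rfl
    · exact hk
    · simp only [map_sub, aeval_X, hk]; ring
  have hfinal : aeval (aeval (-(ρ (g 0) + ρ (g 1) + ρ (g 2))) r) Q = 0 := by
    rw [← aeval_comp]
    exact aeval_eq_zero_of_dvd hQ hb0
  rw [key] at hfinal
  simp only [Polynomial.aeval_algHom_apply, ← map_add, ← map_neg] at hfinal
  rwa [hρ] at hfinal

/-- For three commuting operators annihilated by `P`, a relation `P(-(a₁ + a₂ + a₃)) t = 0` passes
to their semisimple and to their nilpotent parts. The proof takes place in the finite-dimensional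
commutative algebra generated by the `aᵢ`, modulo the annihilator of `t`. -/
theorem IsJordanChevalleyPolynomial.aeval_neg_add_apply {T : Type*} [AddCommGroup T] [Module ℝ T]
    {P q : ℝ[X]} (h : IsJordanChevalleyPolynomial P q) (hP : P.Monic) {a : Fin 3 → Module.End ℝ T}
    (hc : ∀ i j, Commute (a i) (a j)) (ha : ∀ i, aeval (a i) P = 0) {t : T}
    (ht : aeval (-(a 0 + a 1 + a 2)) P t = 0) {r Q : ℝ[X]} (hr : r = q ∨ r = X - q)
    (hQ : P ∣ Q.comp r) :
    aeval (-(aeval (a 0) r + aeval (a 1) r + aeval (a 2) r)) Q t = 0 := by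
  let S : Set (Module.End ℝ T) := Set.range a
  have hS : ∀ x ∈ S, ∀ y ∈ S, x * y = y * x := by
    rintro _ ⟨i, rfl⟩ _ ⟨j, rfl⟩; exact hc i j
  let A := Algebra.adjoin ℝ S
  let _ : CommRing A :=
    { A.toRing with mul_comm := (Algebra.isMulCommutative_adjoin ℝ hS).is_comm.comm }
  let g : Fin 3 → A := fun i => ⟨a i, Algebra.subset_adjoin ⟨i, rfl⟩⟩
  have hval : ∀ (x : A) (p : ℝ[X]),
      ((aeval x p : A) : Module.End ℝ T) = aeval (x : Module.End ℝ T) p :=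
    fun x p => (Polynomial.aeval_algHom_apply A.val x p).symm
  let I : Ideal A :=
    { carrier := {x | (x : Module.End ℝ T) t = 0}
      add_mem' := fun {x y} hx hy => by
        change (x : Module.End ℝ T) t + (y : Module.End ℝ T) t = 0
        rw [show (x : Module.End ℝ T) t = 0 from hx, show (y : Module.End ℝ T) t = 0 from hy,
          add_zero]
      zero_mem' := rfl
      smul_mem' := fun c x hx => by
        change (c : Module.End ℝ T) ((x : Module.End ℝ T) t) = 0
        rw [show (x : Module.End ℝ T) t = 0 from hx, map_zero] }
  have hg : ∀ i, aeval (g i) P = 0 := fun i => Subtype.ext ((hval _ _).trans (ha i))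
  have hgint : ∀ i, IsIntegral ℝ (g i) := fun i => ⟨P, hP, hg i⟩
  have hfin : Module.Finite ℝ A := by
    have htop : Algebra.adjoin ℝ (Set.range g) = ⊤ := by
      rw [eq_top_iff]
      intro x _
      have hx := x.2
      have himg : A.val '' Set.range g = S := by
        rw [← Set.range_comp]; rfl
      have h1 : (x : Module.End ℝ T) ∈ (Algebra.adjoin ℝ (Set.range g)).map A.val := by
        rw [AlgHom.map_adjoin, himg]; exact hx
      obtain ⟨y, hy, hyx⟩ := h1
      rwa [← Subtype.ext (a1 := y) (a2 := x) hyx]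
    have hfg := fg_adjoin_of_finite (R := ℝ) (s := Set.range g) (Set.finite_range g)
      (by rintro _ ⟨i, rfl⟩; exact hgint i)
    rw [htop] at hfg
    exact ⟨hfg⟩
  have h0 : aeval (-(g 0 + g 1 + g 2)) P ∈ I := by
    change ((aeval (-(g 0 + g 1 + g 2)) P : A) : Module.End ℝ T) t = 0
    rw [hval]
    exact ht
  have hfinal := h.aeval_neg_add_mem hg h0 hr hQ
  change ((aeval (-(aeval (g 0) r + aeval (g 1) r + aeval (g 2) r)) Q : A) : Module.End ℝ T) t = 0
    at hfinal
  rw [hval] at hfinal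
  change aeval (-(((aeval (g 0) r : A) : Module.End ℝ T) + ((aeval (g 1) r : A) : Module.End ℝ T)
    + ((aeval (g 2) r : A) : Module.End ℝ T))) Q t = 0 at hfinal
  rwa [hval, hval, hval] at hfinal

/-- The minimal polynomial of `r(f)` depends only on the minimal polynomial of `f`. -/
theorem minpoly_aeval_eq [FiniteDimensional ℝ V] {V' : Type*} [AddCommGroup V'] [Module ℝ V']
    [FiniteDimensional ℝ V']
    {f : Module.End ℝ V} {g : Module.End ℝ V'} (h : minpoly ℝ f = minpoly ℝ g) (r : ℝ[X]) :
    minpoly ℝ (aeval f r) = minpoly ℝ (aeval g r) := by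
  have hf := minpoly.monic (Algebra.IsIntegral.isIntegral (R := ℝ) (aeval f r))
  have hg := minpoly.monic (Algebra.IsIntegral.isIntegral (R := ℝ) (aeval g r))
  refine Polynomial.eq_of_monic_of_associated hf hg (associated_of_dvd_dvd ?_ ?_)
  · refine minpoly.dvd _ _ ?_
    rw [← aeval_comp]
    refine aeval_eq_zero_of_dvd (h.dvd.trans ?_) (minpoly.aeval ℝ f)
    exact minpoly.dvd _ _ (by rw [aeval_comp, minpoly.aeval])
  · refine minpoly.dvd _ _ ?_
    rw [← aeval_comp]
    refine aeval_eq_zero_of_dvd (h.symm.dvd.trans ?_) (minpoly.aeval ℝ g)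
    exact minpoly.dvd _ _ (by rw [aeval_comp, minpoly.aeval])

end JordanChevalleyPolynomial

/-! ### The Clifford action on the exterior algebra of a fibre -/

section FibreClifford

variable {V : Type*} [AddCommGroup V] [Module ℝ V] [TopologicalSpace V]

theorem contract_add_left {k : ℕ} (v w : V) (θ : V [⋀^Fin (k + 1)]→L[ℝ] ℝ) :
    contract (v + w) θ = contract v θ + contract w θ := by
  ext m
  exact θ.toAlternatingMap.map_vecCons_add m v w

theorem contract_smul_left {k : ℕ} (c : ℝ) (v : V) (θ : V [⋀^Fin (k + 1)]→L[ℝ] ℝ) :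
    contract (c • v) θ = c • contract v θ := by
  ext m
  exact θ.toAlternatingMap.map_vecCons_smul m c v

theorem contract_contract {k : ℕ} (v : V) (θ : V [⋀^Fin (k + 2)]→L[ℝ] ℝ) :
    contract v (contract v θ) = 0 := by
  ext m
  exact θ.toAlternatingMap.map_eq_zero_of_eq _ (i := 0) (j := 1) rfl (by simp)

theorem wedge_zero {k : ℕ} (α : V →L[ℝ] ℝ) : wedge α (0 : V [⋀^Fin k]→L[ℝ] ℝ) = 0 := by
  ext m
  simp [wedge_apply]

theorem contract_zero {k : ℕ} (v : V) : contract v (0 : V [⋀^Fin (k + 1)]→L[ℝ] ℝ) = 0 := rfl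

theorem wedge_add_left {k : ℕ} (α β : V →L[ℝ] ℝ) (θ : V [⋀^Fin k]→L[ℝ] ℝ) :
    wedge (α + β) θ = wedge α θ + wedge β θ := by
  ext m
  simp [wedge_apply, add_mul, mul_add, Finset.sum_add_distrib]

theorem wedge_smul_left {k : ℕ} (c : ℝ) (α : V →L[ℝ] ℝ) (θ : V [⋀^Fin k]→L[ℝ] ℝ) :
    wedge (c • α) θ = c • wedge α θ := by
  ext m
  simp only [wedge_apply, ContinuousAlternatingMap.smul_apply, smul_eq_mul, Finset.mul_sum,
    smul_apply]
  exact Finset.sum_congr rfl fun i _ => by ring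

theorem wedge_wedge {k : ℕ} (α : V →L[ℝ] ℝ) (θ : V [⋀^Fin k]→L[ℝ] ℝ) :
    wedge α (wedge α θ) = 0 := by
  have h := AlternatingMap.alternatizeUncurryFin_alternatizeUncurryFinLM_comp_of_symmetric
    (f := (α : V →ₗ[ℝ] ℝ).smulRight ((α : V →ₗ[ℝ] ℝ).smulRight θ.toAlternatingMap))
    (fun x y => by simp only [LinearMap.smulRight_apply, LinearMap.smul_apply]; rw [smul_comm])
  ext m
  refine Eq.trans ?_ (DFunLike.congr_fun h m)
  rw [wedge_apply, AlternatingMap.alternatizeUncurryFin_apply]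
  refine Finset.sum_congr rfl fun i _ => ?_
  simp [wedge_apply, AlternatingMap.alternatizeUncurryFin_apply]

theorem contract_wedge_zero (v : V) (α : V →L[ℝ] ℝ) (θ : V [⋀^Fin 0]→L[ℝ] ℝ) :
    contract v (wedge α θ) = α v • θ := by
  ext m
  simp only [contract_apply, wedge_apply, ContinuousAlternatingMap.smul_apply, smul_eq_mul]
  simp [Subsingleton.elim _ m]

theorem contract_wedge {k : ℕ} (v : V) (α : V →L[ℝ] ℝ) (θ : V [⋀^Fin (k + 1)]→L[ℝ] ℝ) :
    contract v (wedge α θ) + wedge α (contract v θ) = α v • θ := by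
  ext m
  simp only [contract_apply, wedge_apply, ContinuousAlternatingMap.smul_apply, smul_eq_mul,
    ContinuousAlternatingMap.add_apply]
  rw [Fin.sum_univ_succ, add_assoc, ← Finset.sum_add_distrib, Finset.sum_eq_zero, add_zero]
  · simp [Fin.removeNth_zero]
  · intro i _
    have : Fin.removeNth i.succ (Matrix.vecCons v m) = Matrix.vecCons v (i.removeNth m) := by
      funext j
      refine Fin.cases ?_ (fun j => ?_) j
      · simp [Fin.removeNth, Matrix.vecCons]
      · simp [Fin.removeNth, Matrix.vecCons]
    rw [this]
    simp [pow_succ]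

/-- Sequences of alternating forms on `V`, one in each degree. -/
def FibreForms (V : Type*) [AddCommGroup V] [Module ℝ V] [TopologicalSpace V] : Type _ :=
  ∀ k : ℕ, V [⋀^Fin k]→L[ℝ] ℝ

instance : AddCommGroup (FibreForms V) :=
  inferInstanceAs (AddCommGroup (∀ k : ℕ, V [⋀^Fin k]→L[ℝ] ℝ))

instance : Module ℝ (FibreForms V) := inferInstanceAs (Module ℝ (∀ k : ℕ, V [⋀^Fin k]→L[ℝ] ℝ))

@[simp] theorem FibreForms.add_apply (θ η : FibreForms V) (k : ℕ) : (θ + η) k = θ k + η k := rfl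

@[simp] theorem FibreForms.sub_apply (θ η : FibreForms V) (k : ℕ) : (θ - η) k = θ k - η k := rfl

@[simp] theorem FibreForms.neg_apply (θ : FibreForms V) (k : ℕ) : (-θ) k = -θ k := rfl

@[simp] theorem FibreForms.smul_apply (c : ℝ) (θ : FibreForms V) (k : ℕ) :
    (c • θ) k = c • θ k := rfl

@[simp] theorem FibreForms.zero_apply (k : ℕ) : (0 : FibreForms V) k = 0 := rfl

theorem FibreForms.sum_apply {ι : Type*} (s : Finset ι) (θ : ι → FibreForms V) (k : ℕ) :
    (∑ i ∈ s, θ i) k = ∑ i ∈ s, θ i k := Finset.sum_apply k s θ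

/-- Exterior multiplication by a covector on all degrees at once. -/
def fibreWedge (α : V →L[ℝ] ℝ) (θ : FibreForms V) : FibreForms V
  | 0 => 0
  | k + 1 => wedge α (θ k)

/-- The Clifford action `θ ↦ ι_v θ + α ∧ θ` of `v + α` on forms on a fibre. -/
def fibreClifford : (V × (V →L[ℝ] ℝ)) →ₗ[ℝ] Module.End ℝ (FibreForms V) :=
  LinearMap.mk₂ ℝ (fun x θ k => contract x.1 (θ (k + 1)) + fibreWedge x.2 θ k)
    (fun x y θ => by
      funext k
      change _ = (contract x.1 (θ (k + 1)) + fibreWedge x.2 θ k) +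
        (contract y.1 (θ (k + 1)) + fibreWedge y.2 θ k)
      cases k with
      | zero => simp [fibreWedge, contract_add_left]
      | succ k =>
        simp only [fibreWedge, Prod.fst_add, Prod.snd_add, contract_add_left, wedge_add_left]
        abel)
    (fun c x θ => by
      funext k
      change _ = c • (contract x.1 (θ (k + 1)) + fibreWedge x.2 θ k)
      cases k <;> simp [fibreWedge, contract_smul_left, wedge_smul_left])
    (fun x θ η => by
      funext k
      change _ = (contract x.1 (θ (k + 1)) + fibreWedge x.2 θ k) +
        (contract x.1 (η (k + 1)) + fibreWedge x.2 η k)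
      cases k with
      | zero => simp [fibreWedge, contract_add]
      | succ k =>
        simp only [fibreWedge, contract_add, wedge_add, FibreForms.add_apply]
        abel)
    (fun c x θ => by
      funext k
      change _ = c • (contract x.1 (θ (k + 1)) + fibreWedge x.2 θ k)
      cases k <;> simp [fibreWedge, contract_smul, wedge_smul])

theorem fibreClifford_apply_zero (x : V × (V →L[ℝ] ℝ)) (θ : FibreForms V) :
    fibreClifford x θ 0 = contract x.1 (θ 1) := add_zero _

theorem fibreClifford_apply_succ (x : V × (V →L[ℝ] ℝ)) (θ : FibreForms V) (k : ℕ) :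
    fibreClifford x θ (k + 1) = contract x.1 (θ (k + 2)) + wedge x.2 (θ k) := rfl

theorem fibreClifford_mul_self (x : V × (V →L[ℝ] ℝ)) :
    fibreClifford x * fibreClifford x = x.2 x.1 • 1 := by
  refine LinearMap.ext fun θ => funext fun k => ?_
  rw [Module.End.mul_apply]
  match k with
  | 0 =>
    rw [fibreClifford_apply_zero, fibreClifford_apply_succ, contract_add, contract_contract,
      contract_wedge_zero, zero_add]
    rfl
  | 1 =>
    rw [fibreClifford_apply_succ, fibreClifford_apply_succ, fibreClifford_apply_zero,
      contract_add, contract_contract]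
    exact (congrArg (· + _) (zero_add _)).trans <| contract_wedge x.1 x.2 (θ 1)
  | k + 2 =>
    rw [fibreClifford_apply_succ, fibreClifford_apply_succ, fibreClifford_apply_succ,
      contract_add, contract_contract, zero_add, wedge_add, ← add_assoc, contract_wedge,
      wedge_wedge, add_zero]
    rfl

/-- The Clifford relation. -/
theorem fibreClifford_anticomm (x y : V × (V →L[ℝ] ℝ)) :
    fibreClifford x * fibreClifford y + fibreClifford y * fibreClifford x =
      (x.2 y.1 + y.2 x.1) • 1 := by
  have h := fibreClifford_mul_self (x + y)
  rw [map_add, add_mul, mul_add, mul_add, fibreClifford_mul_self, fibreClifford_mul_self] at h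
  simp only [Prod.fst_add, Prod.snd_add, add_apply, map_add, add_smul] at h ⊢
  have h2 := sub_eq_zero.2 h
  rw [← sub_eq_zero, ← h2]
  abel

/-- The commutator of a product of two Clifford actions with a third one is a Clifford action. -/
theorem fibreClifford_mul_commutator (a b z : V × (V →L[ℝ] ℝ)) :
    fibreClifford a * fibreClifford b * fibreClifford z -
        fibreClifford z * (fibreClifford a * fibreClifford b) =
      (b.2 z.1 + z.2 b.1) • fibreClifford a - (a.2 z.1 + z.2 a.1) • fibreClifford b := by
  have h1 := fibreClifford_anticomm b z
  have h2 := fibreClifford_anticomm a z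
  have e1 : (b.2 z.1 + z.2 b.1) • fibreClifford a = fibreClifford a *
      (fibreClifford b * fibreClifford z + fibreClifford z * fibreClifford b) := by
    rw [h1, mul_smul_comm, mul_one]
  have e2 : (a.2 z.1 + z.2 a.1) • fibreClifford b =
      (fibreClifford a * fibreClifford z + fibreClifford z * fibreClifford a) *
        fibreClifford b := by
    rw [h2, smul_mul_assoc, one_mul]
  rw [e1, e2]
  noncomm_ring

/-- Pullback of forms along a linear map of fibres. -/
def fibrePull {W : Type*} [AddCommGroup W] [Module ℝ W] [TopologicalSpace W] (A : W →L[ℝ] V) :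
    FibreForms V →ₗ[ℝ] FibreForms W where
  toFun θ k := (θ k).compContinuousLinearMap A
  map_add' _ _ := rfl
  map_smul' _ _ := rfl

theorem fibrePull_fibreClifford {W : Type*} [AddCommGroup W] [Module ℝ W] [TopologicalSpace W]
    (A : W →L[ℝ] V) (w : W) (α : V →L[ℝ] ℝ) (θ : FibreForms V) :
    fibrePull A (fibreClifford (A w, α) θ) =
      fibreClifford (w, α.comp A) (fibrePull A θ) := by
  funext k
  cases k with
  | zero =>
    rw [fibreClifford_apply_zero]
    exact (congrArg (fun η => ContinuousAlternatingMap.compContinuousLinearMap η A)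
      (fibreClifford_apply_zero _ _)).trans (contract_comp A w (θ 1))
  | succ k =>
    rw [fibreClifford_apply_succ]
    exact congrArg₂ (· + ·) (contract_comp A w (θ (k + 2))) (wedge_comp A α (θ k))

/-- The operator `(-1)^k` on `k`-forms on a fibre. -/
def fibreParity : Module.End ℝ (FibreForms V) where
  toFun θ k := (-1 : ℝ) ^ k • θ k
  map_add' _ _ := by funext k; exact smul_add _ _ _
  map_smul' r θ := by funext k; exact smul_comm _ r (θ k)

theorem fibreParity_mul_self : fibreParity * fibreParity = (1 : Module.End ℝ (FibreForms V)) := by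
  refine LinearMap.ext fun θ => funext fun k => ?_
  change (-1 : ℝ) ^ k • (-1 : ℝ) ^ k • θ k = θ k
  rw [smul_smul, ← mul_pow]
  simp

theorem fibreParity_mul_fibreClifford (x : V × (V →L[ℝ] ℝ)) :
    fibreParity * fibreClifford x = -(fibreClifford x * fibreParity) := by
  refine LinearMap.ext fun θ => funext fun k => ?_
  cases k with
  | zero =>
    change (-1 : ℝ) ^ 0 • fibreClifford x θ 0 = -(fibreClifford x (fibreParity θ) 0)
    rw [fibreClifford_apply_zero, fibreClifford_apply_zero]
    change _ = -(contract x.1 ((-1 : ℝ) ^ 1 • θ 1))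
    ext m
    simp
  | succ k =>
    change (-1 : ℝ) ^ (k + 1) • fibreClifford x θ (k + 1) =
      -(fibreClifford x (fibreParity θ) (k + 1))
    rw [fibreClifford_apply_succ, fibreClifford_apply_succ]
    change _ = -(contract x.1 ((-1 : ℝ) ^ (k + 2) • θ (k + 2)) + wedge x.2 ((-1 : ℝ) ^ k • θ k))
    rw [wedge_smul]
    ext m
    simp [pow_succ]
    ring

/-! ### The lift of a skew endomorphism of a fibre -/

variable {ι κ : Type*} [Fintype ι] [Fintype κ]

/-- The families `e` of vectors and `ξ` of covectors form a resolution of the identity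
`∑ i, ξ i ⊗ e i = id`. -/
def IsResolution (e : ι → V) (ξ : ι → V →L[ℝ] ℝ) : Prop := ∀ v, ∑ i, ξ i v • e i = v

theorem IsResolution.sum_smul {e : ι → V} {ξ : ι → V →L[ℝ] ℝ}
    (h : IsResolution e ξ) (α : V →L[ℝ] ℝ) : ∑ i, α (e i) • ξ i = α := by
  ext v
  conv_rhs => rw [← h v]
  simp [mul_comm]

/-- The trace of a bilinear map over a resolution of the identity does not depend on the
resolution. -/
theorem IsResolution.sum_eq {N : Type*} [AddCommGroup N] [Module ℝ N]
    {e : ι → V} {ξ : ι → V →L[ℝ] ℝ} (h : IsResolution e ξ) {e' : κ → V} {ξ' : κ → V →L[ℝ] ℝ}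
    (h' : IsResolution e' ξ') (B : V →ₗ[ℝ] (V →L[ℝ] ℝ) →ₗ[ℝ] N) :
    ∑ i, B (e i) (ξ i) = ∑ j, B (e' j) (ξ' j) := by
  have h1 : ∀ i, B (e i) (ξ i) = ∑ j, ξ i (e' j) • B (e i) (ξ' j) := fun i => by
    conv_lhs => rw [← h'.sum_smul (ξ i)]
    simp
  simp_rw [h1]
  rw [Finset.sum_comm]
  refine Finset.sum_congr rfl fun j _ => ?_
  conv_rhs => rw [← h (e' j)]
  simp

/-- The lift of an endomorphism `A` of `V ⊕ V*` to forms, written in a resolution of the identity: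
`½ ∑ᵢ (A eᵢ · ξᵢ + A ξᵢ · eᵢ)`, with the constant `½ ∑ᵢ ξᵢ (A eᵢ)` subtracted
so that `1` is mapped to a 2-form. -/
def fibreLift (A : Module.End ℝ (V × (V →L[ℝ] ℝ))) (e : ι → V) (ξ : ι → V →L[ℝ] ℝ) :
    Module.End ℝ (FibreForms V) :=
  (2⁻¹ : ℝ) • ∑ i, (fibreClifford (A (e i, 0)) * fibreClifford (0, ξ i) +
    fibreClifford (A (0, ξ i)) * fibreClifford (e i, 0) - ξ i (A (e i, 0)).1 • 1)

theorem fibreLift_eq (A : Module.End ℝ (V × (V →L[ℝ] ℝ)))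
    {e : ι → V} {ξ : ι → V →L[ℝ] ℝ} (h : IsResolution e ξ) {e' : κ → V} {ξ' : κ → V →L[ℝ] ℝ}
    (h' : IsResolution e' ξ') : fibreLift A e ξ = fibreLift A e' ξ' := by
  let B : V →ₗ[ℝ] (V →L[ℝ] ℝ) →ₗ[ℝ] Module.End ℝ (FibreForms V) := LinearMap.mk₂ ℝ
    (fun v α => fibreClifford (A (v, 0)) * fibreClifford (0, α) +
      fibreClifford (A (0, α)) * fibreClifford (v, 0) - α (A (v, 0)).1 • 1)
    (fun v w α => by
      have : ((v + w, 0) : V × (V →L[ℝ] ℝ)) = (v, 0) + (w, 0) := by simp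
      simp only [this, map_add, add_mul, mul_add, Prod.fst_add, add_smul]
      abel)
    (fun c v α => by
      have : ((c • v, 0) : V × (V →L[ℝ] ℝ)) = c • (v, 0) := by simp
      simp only [this, map_smul, smul_mul_assoc, mul_smul_comm, Prod.smul_fst, smul_sub, smul_add,
        smul_eq_mul, mul_smul])
    (fun v α β => by
      have : ((0, α + β) : V × (V →L[ℝ] ℝ)) = (0, α) + (0, β) := by simp
      simp only [this, map_add, add_mul, mul_add, add_apply, add_smul]
      abel)
    (fun c v α => by
      have : ((0, c • α) : V × (V →L[ℝ] ℝ)) = c • (0, α) := by simp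
      simp only [this, map_smul, smul_mul_assoc, mul_smul_comm, smul_apply, smul_sub, smul_add,
        smul_eq_mul, mul_smul])
  exact congrArg ((2⁻¹ : ℝ) • ·) (h.sum_eq h' B)

/-- The lift of a skew endomorphism `A` implements `A` on the Clifford action. -/
theorem fibreLift_commutator {A : Module.End ℝ (V × (V →L[ℝ] ℝ))}
    (hA : ∀ x y, ((A x).2 y.1 + y.2 (A x).1) + (x.2 (A y).1 + (A y).2 x.1) = 0)
    {e : ι → V} {ξ : ι → V →L[ℝ] ℝ} (h : IsResolution e ξ) (z : V × (V →L[ℝ] ℝ)) :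
    fibreLift A e ξ * fibreClifford z - fibreClifford z * fibreLift A e ξ =
      fibreClifford (A z) := by
  have hterm : ∀ i, (fibreClifford (A (e i, 0)) * fibreClifford (0, ξ i) +
        fibreClifford (A (0, ξ i)) * fibreClifford (e i, 0) - ξ i (A (e i, 0)).1 • 1) *
          fibreClifford z - fibreClifford z *
        (fibreClifford (A (e i, 0)) * fibreClifford (0, ξ i) +
        fibreClifford (A (0, ξ i)) * fibreClifford (e i, 0) - ξ i (A (e i, 0)).1 • 1) =
      fibreClifford (A (ξ i z.1 • (e i, 0))) + fibreClifford (A (z.2 (e i) • (0, ξ i))) +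
        (fibreClifford (0, (A z).2 (e i) • ξ i) + fibreClifford (ξ i (A z).1 • e i, 0)) := by
    intro i
    have h1 := fibreClifford_mul_commutator (A (e i, 0)) (0, ξ i) z
    have h2 := fibreClifford_mul_commutator (A (0, ξ i)) (e i, 0) z
    have h3 := hA (e i, 0) z
    have h4 := hA (0, ξ i) z
    simp only [map_zero, zero_apply, add_zero, zero_add] at h1 h2 h3 h4
    have e3 : (A z).2 (e i) = -((A (e i, 0)).2 z.1 + z.2 (A (e i, 0)).1) := by linarith
    have e4 : ξ i (A z).1 = -((A (0, ξ i)).2 z.1 + z.2 (A (0, ξ i)).1) := by linarith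
    have e5 : ((0, (A z).2 (e i) • ξ i) : V × (V →L[ℝ] ℝ)) = (A z).2 (e i) • (0, ξ i) := by simp
    have e6 : ((ξ i (A z).1 • e i, 0) : V × (V →L[ℝ] ℝ)) = ξ i (A z).1 • (e i, 0) := by simp
    rw [e5, e6]
    simp only [map_smul]
    rw [e3, e4, neg_smul, neg_smul]
    rw [sub_mul, mul_sub, add_mul, mul_add, smul_mul_assoc, mul_smul_comm, one_mul, mul_one]
    rw [sub_sub_sub_cancel_right, add_sub_add_comm, h1, h2]
    abel
  rw [fibreLift, smul_mul_assoc, mul_smul_comm, ← smul_sub, Finset.sum_mul, Finset.mul_sum,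
    ← Finset.sum_sub_distrib, Finset.sum_congr rfl fun i _ => hterm i]
  simp only [Finset.sum_add_distrib, ← map_sum]
  have s1 : ∑ i, ξ i z.1 • ((e i, 0) : V × (V →L[ℝ] ℝ)) = (z.1, 0) := by
    refine Prod.ext ?_ ?_
    · simp [Prod.fst_sum, h z.1]
    · simp [Prod.snd_sum]
  have s2 : ∑ i, z.2 (e i) • ((0, ξ i) : V × (V →L[ℝ] ℝ)) = (0, z.2) := by
    refine Prod.ext ?_ ?_
    · simp [Prod.fst_sum]
    · simp [Prod.snd_sum, h.sum_smul z.2]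
  have s3 : ∑ i, ((0, (A z).2 (e i) • ξ i) : V × (V →L[ℝ] ℝ)) = (0, (A z).2) := by
    refine Prod.ext ?_ ?_
    · simp [Prod.fst_sum]
    · simp [Prod.snd_sum, h.sum_smul (A z).2]
  have s4 : ∑ i, ((ξ i (A z).1 • e i, 0) : V × (V →L[ℝ] ℝ)) = ((A z).1, 0) := by
    refine Prod.ext ?_ ?_
    · simp [Prod.fst_sum, h (A z).1]
    · simp [Prod.snd_sum]
  rw [s1, s2, s3, s4, ← map_add, ← map_add, ← map_add]
  simp only [Prod.mk_add_mk, add_zero, zero_add]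
  rw [← two_smul ℝ, smul_smul]
  norm_num

theorem fibreParity_mul_fibreLift (A : Module.End ℝ (V × (V →L[ℝ] ℝ))) (e : ι → V)
    (ξ : ι → V →L[ℝ] ℝ) :
    fibreParity * fibreLift A e ξ = fibreLift A e ξ * fibreParity := by
  have h2 : ∀ x y : V × (V →L[ℝ] ℝ), fibreParity * (fibreClifford x * fibreClifford y) =
      fibreClifford x * fibreClifford y * fibreParity := by
    intro x y
    rw [← mul_assoc, fibreParity_mul_fibreClifford, neg_mul, mul_assoc,
      fibreParity_mul_fibreClifford, mul_neg, neg_neg, mul_assoc]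
  rw [fibreLift, smul_mul_assoc, mul_smul_comm, Finset.sum_mul, Finset.mul_sum]
  congr 1
  refine Finset.sum_congr rfl fun i _ => ?_
  rw [sub_mul, mul_sub, add_mul, mul_add, h2, h2, smul_mul_assoc, mul_smul_comm, one_mul, mul_one]

/-- The constant function `1` as a form on a fibre. -/
def fibreOne : FibreForms V
  | 0 => ContinuousAlternatingMap.constOfIsEmpty ℝ _ (Fin 0) 1
  | _ + 1 => 0

theorem fibreLift_one (A : Module.End ℝ (V × (V →L[ℝ] ℝ))) (e : ι → V)
    (ξ : ι → V →L[ℝ] ℝ) {k : ℕ} (hk : k ≠ 2) :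
    fibreLift A e ξ fibreOne k = 0 := by
  have h1 : ∀ v : V, fibreClifford (v, 0) fibreOne = 0 := by
    intro v
    funext k
    cases k with
    | zero => rw [fibreClifford_apply_zero]; rfl
    | succ k =>
      rw [fibreClifford_apply_succ]
      ext m
      simp [wedge_apply, fibreOne]
  have h2 : ∀ (α : V →L[ℝ] ℝ) (k : ℕ), k ≠ 1 →
      fibreClifford ((0, α) : V × (V →L[ℝ] ℝ)) fibreOne k = 0 := by
    intro α k hk
    match k with
    | 0 => rw [fibreClifford_apply_zero]; rfl
    | 1 => exact absurd rfl hk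
    | k + 2 =>
      rw [fibreClifford_apply_succ]
      simp [fibreOne, wedge_zero, contract_zero]
  have h3 : ∀ (α : V →L[ℝ] ℝ), fibreClifford ((0, α) : V × (V →L[ℝ] ℝ)) fibreOne 1 =
      wedge α (fibreOne 0) := by
    intro α
    rw [fibreClifford_apply_succ]
    simp [fibreOne, contract_zero]
  have hterm : ∀ i, ((fibreClifford (A (e i, 0)) * fibreClifford (0, ξ i) +
        fibreClifford (A (0, ξ i)) * fibreClifford (e i, 0) - ξ i (A (e i, 0)).1 • 1) :
          Module.End ℝ (FibreForms V)) fibreOne k = 0 := by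
    intro i
    change fibreClifford (A (e i, 0)) (fibreClifford (0, ξ i) fibreOne) k +
      fibreClifford (A (0, ξ i)) (fibreClifford (e i, 0) fibreOne) k -
        ξ i (A (e i, 0)).1 • fibreOne k = 0
    rw [h1, map_zero]
    match k with
    | 0 =>
      rw [fibreClifford_apply_zero, h3, contract_wedge_zero]
      simp
    | 1 =>
      rw [fibreClifford_apply_succ, h2 _ _ (by simp), h2 _ _ (by simp)]
      simp [fibreOne, wedge_zero, contract_zero]
    | 2 => exact absurd rfl hk
    | k + 3 =>
      rw [fibreClifford_apply_succ, h2 _ _ (by simp), h2 _ _ (by simp)]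
      simp [fibreOne, wedge_zero, contract_zero]
  rw [fibreLift, LinearMap.smul_apply, LinearMap.sum_apply]
  rw [FibreForms.smul_apply, FibreForms.sum_apply]
  rw [Finset.sum_eq_zero fun i _ => hterm i, smul_zero]

end FibreClifford

/-! ### Operators acting pointwise -/

section Pointwise

variable {E : Type*} [NormedAddCommGroup E] [NormedSpace ℝ E]
  {M : Type*} [TopologicalSpace M] [ChartedSpace E M] [IsManifold 𝓘(ℝ, E) ∞ M]

/-- The value of a differential form at a point. -/
def formAt (p : M) : Forms E M →ₗ[ℝ] FibreForms (TangentSpace 𝓘(ℝ, E) p) where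
  toFun θ k := (θ k).1 p
  map_add' _ _ := rfl
  map_smul' _ _ := rfl

theorem forms_ext {θ η : Forms E M} (h : ∀ p, formAt p θ = formAt p η) : θ = η :=
  funext fun k => Subtype.ext (funext fun p => congrFun (h p) k)

/-- The operator `Ψ` acts on forms at each point `p` through the fibre endomorphism `F p`. -/
def ActsPointwise (Ψ : Operator E M)
    (F : ∀ p : M, Module.End ℝ (FibreForms (TangentSpace 𝓘(ℝ, E) p))) : Prop :=
  ∀ (θ : Forms E M) (p : M), formAt p (Ψ θ) = F p (formAt p θ)

namespace ActsPointwise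

variable {Ψ Χ : Operator E M}
  {F G : ∀ p : M, Module.End ℝ (FibreForms (TangentSpace 𝓘(ℝ, E) p))}

theorem unique (hΨ : ActsPointwise Ψ F) (hΧ : ActsPointwise Χ F) : Ψ = Χ :=
  LinearMap.ext fun θ => forms_ext fun p => (hΨ θ p).trans (hΧ θ p).symm

theorem congr (hΨ : ActsPointwise Ψ F) (h : ∀ p, F p = G p) : ActsPointwise Ψ G := by
  rwa [← (funext h : F = G)]

theorem add (hΨ : ActsPointwise Ψ F) (hΧ : ActsPointwise Χ G) :
    ActsPointwise (Ψ + Χ) (fun p => F p + G p) := fun θ p => by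
  rw [LinearMap.add_apply, map_add, hΨ, hΧ]; rfl

theorem sub (hΨ : ActsPointwise Ψ F) (hΧ : ActsPointwise Χ G) :
    ActsPointwise (Ψ - Χ) (fun p => F p - G p) := fun θ p => by
  rw [LinearMap.sub_apply, map_sub, hΨ, hΧ]; rfl

theorem smul (c : ℝ) (hΨ : ActsPointwise Ψ F) :
    ActsPointwise (c • Ψ) (fun p => c • F p) := fun θ p => by
  rw [LinearMap.smul_apply, map_smul, hΨ]; rfl

theorem mul (hΨ : ActsPointwise Ψ F) (hΧ : ActsPointwise Χ G) :
    ActsPointwise (Ψ * Χ) (fun p => F p * G p) := fun θ p => by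
  rw [Module.End.mul_apply, hΨ, hΧ]; rfl

theorem zero : ActsPointwise (0 : Operator E M) (fun _ => 0) := fun θ p => by
  rw [LinearMap.zero_apply, map_zero]; rfl

theorem sum {ι : Type*} (s : Finset ι) {Ψ : ι → Operator E M}
    {F : ι → ∀ p : M, Module.End ℝ (FibreForms (TangentSpace 𝓘(ℝ, E) p))}
    (h : ∀ i ∈ s, ActsPointwise (Ψ i) (F i)) :
    ActsPointwise (∑ i ∈ s, Ψ i) (fun p => ∑ i ∈ s, F i p) := fun θ p => by
  rw [LinearMap.sum_apply, map_sum, LinearMap.sum_apply]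
  exact Finset.sum_congr rfl fun i hi => h i hi θ p

end ActsPointwise

theorem actsPointwise_clifford (x : GenSection E M) :
    ActsPointwise (clifford x) (fun p => fibreClifford (x.toFun p)) := fun θ p => by
  funext k
  cases k <;> rfl

theorem actsPointwise_mulFun (f : C^∞⟮𝓘(ℝ, E), M; 𝓘(ℝ, ℝ), ℝ⟯) :
    ActsPointwise (mulFun f) (fun p => f p • 1) := fun _ _ => rfl

theorem actsPointwise_parity : ActsPointwise (parity E M) (fun _ => fibreParity) := fun _ _ => rfl

theorem formAt_oneForm (p : M) : formAt p (oneForm E M) = fibreOne := by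
  funext k
  cases k <;> rfl

end Pointwise

/-! ### Sections with prescribed germs -/

section Sections

variable {E : Type*} [NormedAddCommGroup E] [NormedSpace ℝ E]
  {M : Type*} [TopologicalSpace M] [ChartedSpace E M] [IsManifold 𝓘(ℝ, E) ∞ M]

variable (E M) in
/-- The smooth sections of `TM ⊕ T*M`, among all families of values. -/
def sectionSubmodule : Submodule ℝ (∀ p : M, GenTangent E p) where
  carrier := {s | ∃ x : GenSection E M, x.toFun = s}
  add_mem' := by
    rintro _ _ ⟨x, rfl⟩ ⟨y, rfl⟩
    exact ⟨⟨x.toFun + y.toFun, x.smooth_vector.add_section y.smooth_vector,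
      fun c => (x.smooth_covector c).add (y.smooth_covector c)⟩, rfl⟩
  zero_mem' := ⟨⟨0, Bundle.contMDiff_zeroSection ℝ (TangentSpace 𝓘(ℝ, E)),
    fun c => contDiffOn_const (c := 0)⟩, rfl⟩
  smul_mem' := by
    rintro r _ ⟨x, rfl⟩
    exact ⟨⟨r • x.toFun, x.smooth_vector.const_smul_section,
      fun c => contDiffOn_const.smul (x.smooth_covector c) (f := fun _ => r)⟩, rfl⟩

variable (E M) in
/-- The real vector space of smooth sections of `TM ⊕ T*M`. -/
def Sections : Type _ := sectionSubmodule E M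

instance : AddCommGroup (Sections E M) := inferInstanceAs (AddCommGroup (sectionSubmodule E M))

instance : Module ℝ (Sections E M) := inferInstanceAs (Module ℝ (sectionSubmodule E M))

/-- The value of a section at a point. -/
def sectionAt (p : M) : Sections E M →ₗ[ℝ] GenTangent E p where
  toFun s := s.1 p
  map_add' _ _ := rfl
  map_smul' _ _ := rfl

/-- An element of `Sections E M` as a `GenSection`. The choice is harmless, since a `GenSection` is
determined by its values. -/
def toGenSection (s : Sections E M) : GenSection E M := s.2.choose

theorem toGenSection_toFun (s : Sections E M) (p : M) :
    (toGenSection s).toFun p = sectionAt p s := congrFun s.2.choose_spec p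

/-- The change of frame is the differential of the change of charts. -/
theorem coframe_comp_frame {c c' q : M} (hc : q ∈ (chartAt E c).source)
    (hc' : q ∈ (chartAt E c').source) :
    (coframe E c q).comp (frame E c' q) = tangentCoordChange 𝓘(ℝ, E) c' c q := by
  ext v
  have h3 := TangentBundle.symmL_trivializationAt_eq_core (I := 𝓘(ℝ, E)) hc'
  have h4 := TangentBundle.continuousLinearMapAt_trivializationAt_eq_core (I := 𝓘(ℝ, E)) hc
  change coframe E c q (frame E c' q v) = _
  unfold coframe frame
  rw [h3, h4]
  refine tangentCoordChange_comp (I := 𝓘(ℝ, E)) (w := c') (x := q) (y := c) (z := q) ?_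
  simp only [extChartAt_source]
  exact ⟨⟨hc', mem_chart_source E q⟩, hc⟩

/-- Smoothness of a form is a local property. -/
theorem smoothForm_of_eventuallyEq {k : ℕ}
    {θ : ∀ p : M, TangentSpace 𝓘(ℝ, E) p [⋀^Fin k]→L[ℝ] ℝ}
    (h : ∀ p₀, ∃ η : SmoothForm E M k, ∀ᶠ p in 𝓝 p₀, θ p = η.1 p) : θ ∈ SmoothForm E M k := by
  intro c y hy
  obtain ⟨η, hη⟩ := h ((extChartAt 𝓘(ℝ, E) c).symm y)
  have ho := (isOpen_extChartAt_target (I := 𝓘(ℝ, E)) c).mem_nhds hy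
  have hcont := (continuousOn_extChartAt_symm (I := 𝓘(ℝ, E)) c).continuousAt ho
  refine (((η.2 c).contDiffAt ho).congr_of_eventuallyEq ?_).contDiffWithinAt
  filter_upwards [hcont.eventually hη] with z hz
  unfold formInChart
  rw [hz]

theorem ad_apply_of_even {Φ : Operator E M} (hΦ : parityConj Φ = Φ) (χ : Operator E M) :
    ad Φ χ = Φ * χ - χ * Φ := by
  have h1 : evenPart Φ = Φ := by
    rw [evenPart, hΦ, ← two_smul ℝ Φ, smul_smul]; norm_num
  have h2 : oddPart Φ = 0 := by rw [oddPart, hΦ, sub_self, smul_zero]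
  simp [ad, h1, h2]

variable [FiniteDimensional ℝ E] [T2Space M]

/-- The vector field which is constant in the chart at `c`, cut off by a bump function. -/
def bumpVector (c : M) (χ : SmoothBumpFunction 𝓘(ℝ, E) c) (v : E) : GenSection E M where
  toFun q := (χ q • frame E c q v, 0)
  smooth_vector := by
    have h : ContMDiffOn 𝓘(ℝ, E) (𝓘(ℝ, E).prod 𝓘(ℝ, E)) ∞
        (fun q => (⟨q, frame E c q v⟩ : TangentBundle 𝓘(ℝ, E) M))
        (trivializationAt E (TangentSpace 𝓘(ℝ, E)) c).baseSet := by
      refine (Bundle.Trivialization.contMDiffOn_section_baseSet_iff (n := ∞) (IB := 𝓘(ℝ, E))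
        (trivializationAt E (TangentSpace 𝓘(ℝ, E)) c)).2 ?_
      refine (contMDiffOn_const (c := v)).congr fun q hq => ?_
      have hq' : q ∈ (chartAt E c).source := by simpa using hq
      have := coframe_frame hq' v
      unfold coframe at this
      rwa [Bundle.Trivialization.continuousLinearMapAt_apply,
        Bundle.Trivialization.coe_linearMapAt_of_mem _ hq] at this
    refine ContMDiffOn.smul_section_of_tsupport (χ.contMDiff.contMDiffOn)
      (trivializationAt E (TangentSpace 𝓘(ℝ, E)) c).open_baseSet ?_ h
    simpa using χ.tsupport_subset_chartAt_source
  smooth_covector _ := contDiffOn_const (c := 0)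

/-- The 1-form which is constant in the chart at `c`, cut off by a bump function. -/
def bumpCovector (c : M) (χ : SmoothBumpFunction 𝓘(ℝ, E) c) (α : E →L[ℝ] ℝ) : GenSection E M where
  toFun q := (0, χ q • α.comp (coframe E c q))
  smooth_vector := Bundle.contMDiff_zeroSection ℝ (TangentSpace 𝓘(ℝ, E))
  smooth_covector c' := by
    intro y hy
    set q := (extChartAt 𝓘(ℝ, E) c').symm y with hq
    have ho := (isOpen_extChartAt_target (I := 𝓘(ℝ, E)) c').mem_nhds hy
    have hcont := (continuousOn_extChartAt_symm (I := 𝓘(ℝ, E)) c').continuousAt ho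
    refine ContDiffAt.contDiffWithinAt ?_
    by_cases hqs : q ∈ tsupport χ
    · have hqc : q ∈ (chartAt E c).source := χ.tsupport_subset_chartAt_source hqs
      have h1 : ContDiffAt ℝ ∞ (fun z => χ ((extChartAt 𝓘(ℝ, E) c').symm z)) y := by
        have h2 := χ.contMDiff.comp_contMDiffOn
          (contMDiffOn_extChartAt_symm (I := 𝓘(ℝ, E)) (n := ∞) c')
        exact (contMDiffOn_iff_contDiffOn.1 h2).contDiffAt ho
      have h2 : ContDiffAt ℝ ∞ (fun z => tangentCoordChange 𝓘(ℝ, E) c' c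
          ((extChartAt 𝓘(ℝ, E) c').symm z)) y := by
        have h := contDiffWithinAt_ext_coord_change (I := 𝓘(ℝ, E)) (n := ∞) c c' (y := y) (by
          rw [PartialEquiv.trans_source'', PartialEquiv.symm_symm, PartialEquiv.symm_target]
          refine ⟨q, ⟨?_, ?_⟩, (extChartAt 𝓘(ℝ, E) c').right_inv hy⟩
          · exact (extChartAt 𝓘(ℝ, E) c').map_target hy
          · rwa [extChartAt_source])
        rw [modelWithCornersSelf_coe, Set.range_id, contDiffWithinAt_univ] at h
        refine (h.fderiv_right (m := ∞) (by simp)).congr_of_eventuallyEq ?_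
        filter_upwards [ho] with z hz
        rw [tangentCoordChange_def, modelWithCornersSelf_coe, Set.range_id, fderivWithin_univ,
          (extChartAt 𝓘(ℝ, E) c').right_inv hz]
      have h3 : ContDiffAt ℝ ∞ (fun z => χ ((extChartAt 𝓘(ℝ, E) c').symm z) •
          α.comp (tangentCoordChange 𝓘(ℝ, E) c' c ((extChartAt 𝓘(ℝ, E) c').symm z))) y :=
        h1.smul (contDiffAt_const.clm_comp h2)
      refine h3.congr_of_eventuallyEq ?_
      filter_upwards [ho, hcont.preimage_mem_nhds ((chartAt E c).open_source.mem_nhds hqc)]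
        with z hz hz2
      rw [← coframe_comp_frame hz2 (extChartAt_symm_mem hz)]
      rfl
    · refine (contDiffAt_const (c := (0 : E →L[ℝ] ℝ))).congr_of_eventuallyEq ?_
      filter_upwards [hcont.preimage_mem_nhds
        ((isClosed_tsupport χ).isOpen_compl.mem_nhds hqs)] with z hz
      have : χ ((extChartAt 𝓘(ℝ, E) c').symm z) = 0 := image_eq_zero_of_notMem_tsupport hz
      change (χ ((extChartAt 𝓘(ℝ, E) c').symm z) • α.comp
        (coframe E c ((extChartAt 𝓘(ℝ, E) c').symm z))).comp
          (frame E c' ((extChartAt 𝓘(ℝ, E) c').symm z)) = 0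
      rw [this, zero_smul, ContinuousLinearMap.zero_comp]

/-- Near every point there are global sections that form a resolution of the identity. -/
theorem exists_isResolution (p₀ : M) : ∃ x ξ : Fin (Module.finrank ℝ E) → GenSection E M,
    (∀ i p, ((x i).toFun p).2 = 0) ∧ (∀ i p, ((ξ i).toFun p).1 = 0) ∧
    ∀ᶠ p in 𝓝 p₀, IsResolution (fun i => ((x i).toFun p).1) (fun i => ((ξ i).toFun p).2) := by
  obtain ⟨χ⟩ : Nonempty (SmoothBumpFunction 𝓘(ℝ, E) p₀) := inferInstance
  let b := Module.finBasis ℝ E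
  refine ⟨fun i => bumpVector p₀ χ (b i),
    fun i => bumpCovector p₀ χ (LinearMap.toContinuousLinearMap (b.coord i)),
    fun _ _ => rfl, fun _ _ => rfl, ?_⟩
  filter_upwards [χ.eventuallyEq_one, (chartAt E p₀).open_source.mem_nhds (mem_chart_source E p₀)]
    with p hp hs v
  change ∑ i, (χ p • b.coord i (coframe E p₀ p v)) • χ p • frame E p₀ p (b i) = v
  rw [hp]
  simp only [Pi.one_apply, one_smul, ← map_smul, ← map_sum]
  rw [← frame_coframe hs v, coframe_frame hs]
  congr 1
  exact b.sum_repr _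

/-- Smooth sections separate the points of `TM ⊕ T*M`. -/
theorem eq_zero_of_pairing_eq_zero {p : M} {s : GenTangent E p}
    (h : ∀ z : GenSection E M, s.2 (z.toFun p).1 + (z.toFun p).2 s.1 = 0) : s = 0 := by
  obtain ⟨x, ξ, hx, hξ, hres⟩ := exists_isResolution (E := E) p
  have hr := hres.self_of_nhds
  have h1 : ∀ i, s.2 ((x i).toFun p).1 = 0 := fun i => by simpa [hx] using h (x i)
  have h2 : ∀ i, ((ξ i).toFun p).2 s.1 = 0 := fun i => by simpa [hξ] using h (ξ i)
  refine Prod.ext ?_ ?_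
  · rw [← hr s.1]; simp [h2]
  · rw [← hr.sum_smul s.2]; simp [h1]

/-! ### The lift of a skew endomorphism field -/

/-- A basis of `T_p M`, coming from the identification of `T_p M` with the model space `E`. -/
def tangentBasis (p : M) (i : Fin (Module.finrank ℝ E)) : TangentSpace 𝓘(ℝ, E) p :=
  (Module.finBasis ℝ E i : E)

/-- The basis dual to `tangentBasis`. -/
def cotangentBasis (p : M) (i : Fin (Module.finrank ℝ E)) : TangentSpace 𝓘(ℝ, E) p →L[ℝ] ℝ :=
  (LinearMap.toContinuousLinearMap ((Module.finBasis ℝ E).coord i) : E →L[ℝ] ℝ)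

omit [IsManifold 𝓘(ℝ, E) ∞ M] [T2Space M] in
theorem isResolution_tangentBasis (p : M) :
    IsResolution (tangentBasis (E := E) p) (cotangentBasis p) :=
  fun v => (Module.finBasis ℝ E).sum_repr v

/-- The fibrewise lift of an endomorphism field at `p`. -/
def liftAt (A : ∀ p : M, Module.End ℝ (GenTangent E p)) (p : M) :
    Module.End ℝ (FibreForms (TangentSpace 𝓘(ℝ, E) p)) :=
  fibreLift (A p) (tangentBasis p) (cotangentBasis p)

omit [IsManifold 𝓘(ℝ, E) ∞ M] [T2Space M] in
theorem liftAt_eq (A : ∀ p : M, Module.End ℝ (GenTangent E p)) {p : M} {ι : Type*} [Fintype ι]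
    {e : ι → TangentSpace 𝓘(ℝ, E) p} {ξ : ι → TangentSpace 𝓘(ℝ, E) p →L[ℝ] ℝ}
    (h : IsResolution e ξ) : liftAt A p = fibreLift (A p) e ξ :=
  fibreLift_eq _ (isResolution_tangentBasis p) h

theorem liftAt_smooth {A : ∀ p : M, Module.End ℝ (GenTangent E p)} (hA : IsSkewEndomorphism A)
    (θ : Forms E M) (k : ℕ) : (fun p => liftAt A p (formAt p θ) k) ∈ SmoothForm E M k := by
  refine smoothForm_of_eventuallyEq fun p₀ => ?_
  obtain ⟨x, ξ, hx, hξ, hres⟩ := exists_isResolution (E := E) p₀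
  choose Ax hAx using fun i => hA.smooth (x i)
  choose Aξ hAξ using fun i => hA.smooth (ξ i)
  -- the scalar `ξᵢ (A xᵢ)` is written as an anticommutator, so that `Ψ` is a global operator
  let Ψ : Operator E M := (2⁻¹ : ℝ) • ∑ i, (clifford (Ax i) * clifford (ξ i) +
    clifford (Aξ i) * clifford (x i) - (clifford (ξ i) * clifford (Ax i) +
      clifford (Ax i) * clifford (ξ i)))
  refine ⟨Ψ θ k, hres.mono fun p hp => ?_⟩
  have hΨ : ActsPointwise Ψ _ := ActsPointwise.smul _ (ActsPointwise.sum _ fun i _ =>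
    ((((actsPointwise_clifford (Ax i)).mul (actsPointwise_clifford (ξ i))).add
      ((actsPointwise_clifford (Aξ i)).mul (actsPointwise_clifford (x i)))).sub
      (((actsPointwise_clifford (ξ i)).mul (actsPointwise_clifford (Ax i))).add
      ((actsPointwise_clifford (Ax i)).mul (actsPointwise_clifford (ξ i))))))
  refine Eq.trans ?_ (congrFun (hΨ θ p) k).symm
  rw [liftAt_eq A hp, fibreLift]
  have ex : ∀ i, (x i).toFun p = (((x i).toFun p).1, 0) := fun i => Prod.ext rfl (hx i p)
  have eξ : ∀ i, (ξ i).toFun p = (0, ((ξ i).toFun p).2) := fun i => Prod.ext (hξ i p) rfl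
  refine congrArg (fun T : Module.End ℝ (FibreForms (TangentSpace 𝓘(ℝ, E) p)) =>
    ((2⁻¹ : ℝ) • T) (formAt p θ) k) (Finset.sum_congr rfl fun i _ => ?_)
  rw [fibreClifford_anticomm, hAx, hAξ, ← ex, ← eξ, hξ, map_zero, add_zero]

/-- The lift of a skew endomorphism field to the operators on forms. -/
def liftOp {A : ∀ p : M, Module.End ℝ (GenTangent E p)} (hA : IsSkewEndomorphism A) :
    Operator E M where
  toFun θ k := ⟨fun p => liftAt A p (formAt p θ) k, liftAt_smooth hA θ k⟩
  map_add' θ η := forms_ext fun p => by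
    change liftAt A p (formAt p (θ + η)) = liftAt A p (formAt p θ) + liftAt A p (formAt p η)
    rw [map_add, map_add]
  map_smul' r θ := forms_ext fun p => by
    change liftAt A p (formAt p (r • θ)) = r • liftAt A p (formAt p θ)
    rw [map_smul, map_smul]

theorem actsPointwise_liftOp {A : ∀ p : M, Module.End ℝ (GenTangent E p)}
    (hA : IsSkewEndomorphism A) : ActsPointwise (liftOp hA) (liftAt A) := fun _ _ => rfl

omit [T2Space M] in
theorem liftAt_commutator {A : ∀ p : M, Module.End ℝ (GenTangent E p)}
    (hA : IsSkewEndomorphism A) (p : M) (z : GenTangent E p) :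
    liftAt A p * fibreClifford z - fibreClifford z * liftAt A p = fibreClifford (A p z) := by
  refine fibreLift_commutator (V := TangentSpace 𝓘(ℝ, E) p) (fun x y => ?_)
    (isResolution_tangentBasis p) z
  have := hA.skew p x y
  unfold tautInner at this
  linarith

theorem parityConj_liftOp {A : ∀ p : M, Module.End ℝ (GenTangent E p)}
    (hA : IsSkewEndomorphism A) : parityConj (liftOp hA) = liftOp hA := by
  refine (actsPointwise_parity.mul ((actsPointwise_liftOp hA).mul actsPointwise_parity)).unique
    ((actsPointwise_liftOp hA).congr fun p => ?_)
  rw [← mul_assoc, liftAt, fibreParity_mul_fibreLift, mul_assoc, fibreParity_mul_self, mul_one]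

theorem isLift_liftOp {A : ∀ p : M, Module.End ℝ (GenTangent E p)}
    (hA : IsSkewEndomorphism A) : IsLift A (liftOp hA) where
  even := parityConj_liftOp hA
  comm_fun f := by
    rw [ad_apply_of_even (parityConj_liftOp hA)]
    refine (((actsPointwise_liftOp hA).mul (actsPointwise_mulFun f)).sub
      ((actsPointwise_mulFun f).mul (actsPointwise_liftOp hA))).unique
        (ActsPointwise.zero.congr fun p => ?_)
    rw [mul_smul_comm, smul_mul_assoc, mul_one, one_mul, sub_self]
  comm_section x y hxy := by
    rw [ad_apply_of_even (parityConj_liftOp hA)]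
    refine (((actsPointwise_liftOp hA).mul (actsPointwise_clifford x)).sub
      ((actsPointwise_clifford x).mul (actsPointwise_liftOp hA))).unique
        ((actsPointwise_clifford y).congr fun p => ?_)
    rw [liftAt_commutator hA, hxy]
  apply_one k hk := by
    refine Subtype.ext (funext fun p => ?_)
    change liftAt A p (formAt p (oneForm E M)) k = 0
    rw [formAt_oneForm, liftAt, fibreLift_one _ _ _ hk]

end Sections

/-! ### The Dorfman bracket in coordinates -/

section DeRham

variable {E : Type*} [NormedAddCommGroup E] [NormedSpace ℝ E]
  {M : Type*} [TopologicalSpace M] [ChartedSpace E M] [IsManifold 𝓘(ℝ, E) ∞ M]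

/-- The interior product as a continuous bilinear map. -/
def contractL (k : ℕ) : E →L[ℝ] (E [⋀^Fin (k + 1)]→L[ℝ] ℝ) →L[ℝ] (E [⋀^Fin k]→L[ℝ] ℝ) :=
  (ContinuousAlternatingMap.curryLeftLI (𝕜 := ℝ) (E := E) (F := ℝ)
    (n := k)).toContinuousLinearMap.flip

/-- The exterior product with a covector as a continuous bilinear map. -/
def wedgeL (k : ℕ) : (E →L[ℝ] ℝ) →L[ℝ] (E [⋀^Fin k]→L[ℝ] ℝ) →L[ℝ] (E [⋀^Fin (k + 1)]→L[ℝ] ℝ) :=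
  (ContinuousLinearMap.compL ℝ (E [⋀^Fin k]→L[ℝ] ℝ) (E →L[ℝ] E [⋀^Fin k]→L[ℝ] ℝ)
    (E [⋀^Fin (k + 1)]→L[ℝ] ℝ) (ContinuousAlternatingMap.alternatizeUncurryFinCLM ℝ E ℝ)).comp
      (ContinuousLinearMap.smulRightL ℝ E (E [⋀^Fin k]→L[ℝ] ℝ))

theorem wedgeL_apply {k : ℕ} (α : E →L[ℝ] ℝ) (θ : E [⋀^Fin k]→L[ℝ] ℝ) :
    wedgeL k α θ = wedge α θ := by
  ext m
  simp [wedgeL, wedge_apply, ContinuousAlternatingMap.alternatizeUncurryFin_apply]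

theorem fderiv_contract {k : ℕ} {s : E → E × (E →L[ℝ] ℝ)}
    {η : E → E [⋀^Fin (k + 1)]→L[ℝ] ℝ} {y : E} (hs : DifferentiableAt ℝ s y)
    (hη : DifferentiableAt ℝ η y) :
    DifferentiableAt ℝ (fun z => contract (s z).1 (η z)) y ∧
      ∀ v, fderiv ℝ (fun z => contract (s z).1 (η z)) y v =
        contract (fderiv ℝ s y v).1 (η y) + contract (s y).1 (fderiv ℝ η y v) := by
  have h := (contractL k).hasFDerivAt_of_bilinear hs.hasFDerivAt.fst hη.hasFDerivAt
  refine ⟨h.differentiableAt, fun v => ?_⟩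
  exact (DFunLike.congr_fun h.fderiv v).trans (add_comm _ _)

theorem fderiv_wedge {k : ℕ} {s : E → E × (E →L[ℝ] ℝ)}
    {η : E → E [⋀^Fin k]→L[ℝ] ℝ} {y : E} (hs : DifferentiableAt ℝ s y)
    (hη : DifferentiableAt ℝ η y) :
    DifferentiableAt ℝ (fun z => wedge (s z).2 (η z)) y ∧
      ∀ v, fderiv ℝ (fun z => wedge (s z).2 (η z)) y v =
        wedge (fderiv ℝ s y v).2 (η y) + wedge (s y).2 (fderiv ℝ η y v) := by
  have h := (wedgeL k).hasFDerivAt_of_bilinear hs.hasFDerivAt.snd hη.hasFDerivAt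
  have he : (fun z => wedge (s z).2 (η z)) = fun z => wedgeL k (s z).2 (η z) :=
    funext fun z => (wedgeL_apply _ _).symm
  rw [he]
  refine ⟨h.differentiableAt, fun v => ?_⟩
  rw [← wedgeL_apply, ← wedgeL_apply]
  exact (DFunLike.congr_fun h.fderiv v).trans (add_comm _ _)

/-- The coordinate expression at `y`, in the chart at `c`, of a form of mixed degree. -/
def coordForm (c : M) (y : E) (θ : Forms E M) : FibreForms E :=
  fun k => formInChart (θ k).1 c y

/-- The derivative at `y` in the direction `v` of the coordinate expression of a form. -/
def coordDeriv (c : M) (y : E) (v : E) (θ : Forms E M) : FibreForms E :=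
  fun k => fderiv ℝ (formInChart (θ k).1 c) y v

/-- The coordinate expression, in the chart at `c`, of a section of `TM ⊕ T*M`. -/
def coordSection (x : GenSection E M) (c : M) (y : E) : E × (E →L[ℝ] ℝ) :=
  (coframe E c ((extChartAt 𝓘(ℝ, E) c).symm y) (x.toFun ((extChartAt 𝓘(ℝ, E) c).symm y)).1,
    covectorInChart (fun p => (x.toFun p).2) c y)

theorem coordSection_differentiableAt (x : GenSection E M) (c : M) {y : E}
    (hy : y ∈ (extChartAt 𝓘(ℝ, E) c).target) : DifferentiableAt ℝ (coordSection x c) y :=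
  ((((vectorInChart_smooth x c).prodMk (x.smooth_covector c)).contDiffAt
    ((isOpen_extChartAt_target (I := 𝓘(ℝ, E)) c).mem_nhds hy))).differentiableAt (by simp)

theorem formInChart_differentiableAt_of_mem {k : ℕ} (θ : SmoothForm E M k) (c : M) {y : E}
    (hy : y ∈ (extChartAt 𝓘(ℝ, E) c).target) : DifferentiableAt ℝ (formInChart θ.1 c) y :=
  ((θ.2 c).contDiffAt ((isOpen_extChartAt_target (I := 𝓘(ℝ, E)) c).mem_nhds
    hy)).differentiableAt (by simp)

theorem coordForm_eq_fibrePull (c : M) (y : E) (θ : Forms E M) :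
    coordForm c y θ = fibrePull (frame E c ((extChartAt 𝓘(ℝ, E) c).symm y))
      (formAt ((extChartAt 𝓘(ℝ, E) c).symm y) θ) := rfl

theorem formAt_eq_fibrePull {c : M} {y : E} (hy : y ∈ (extChartAt 𝓘(ℝ, E) c).target)
    (θ : Forms E M) : formAt ((extChartAt 𝓘(ℝ, E) c).symm y) θ =
      fibrePull (coframe E c ((extChartAt 𝓘(ℝ, E) c).symm y)) (coordForm c y θ) := by
  funext k
  ext m
  change _ = ((θ k).1 ((extChartAt 𝓘(ℝ, E) c).symm y)) fun i =>
    frame E c _ (coframe E c _ (m i))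
  simp only [frame_coframe (extChartAt_symm_mem hy)]
  rfl

theorem coordForm_clifford (x : GenSection E M) {c : M} {y : E}
    (hy : y ∈ (extChartAt 𝓘(ℝ, E) c).target) (θ : Forms E M) :
    coordForm c y (clifford x θ) = fibreClifford (coordSection x c y) (coordForm c y θ) := by
  have hv := frame_coframe (extChartAt_symm_mem hy)
    (x.toFun ((extChartAt 𝓘(ℝ, E) c).symm y)).1
  rw [coordForm_eq_fibrePull, actsPointwise_clifford, coordForm_eq_fibrePull]
  refine Eq.trans ?_ (fibrePull_fibreClifford (frame E c ((extChartAt 𝓘(ℝ, E) c).symm y))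
    (coframe E c ((extChartAt 𝓘(ℝ, E) c).symm y) (x.toFun ((extChartAt 𝓘(ℝ, E) c).symm y)).1)
    (x.toFun ((extChartAt 𝓘(ℝ, E) c).symm y)).2
    (formAt ((extChartAt 𝓘(ℝ, E) c).symm y) θ))
  rw [hv]

/-- The product rule for the Clifford action. -/
theorem coordDeriv_clifford (x : GenSection E M) {c : M} {y : E}
    (hy : y ∈ (extChartAt 𝓘(ℝ, E) c).target) (v : E) (θ : Forms E M) :
    coordDeriv c y v (clifford x θ) =
      fibreClifford (fderiv ℝ (coordSection x c) y v) (coordForm c y θ) +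
        fibreClifford (coordSection x c y) (coordDeriv c y v θ) := by
  have hx := coordSection_differentiableAt x c hy
  have hθ : ∀ k, DifferentiableAt ℝ (formInChart (θ k).1 c) y :=
    fun k => formInChart_differentiableAt_of_mem (θ k) c hy
  have ht := (isOpen_extChartAt_target (I := 𝓘(ℝ, E)) c).mem_nhds hy
  funext k
  rw [FibreForms.add_apply]
  cases k with
  | zero =>
    have he : formInChart (clifford x θ 0).1 c =ᶠ[𝓝 y]
        fun z => contract (coordSection x c z).1 (formInChart (θ 1).1 c z) := by
      filter_upwards [ht] with z hz
      exact (congrFun (coordForm_clifford x hz θ) 0).trans (fibreClifford_apply_zero _ _)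
    rw [fibreClifford_apply_zero, fibreClifford_apply_zero]
    exact (DFunLike.congr_fun he.fderiv_eq v).trans
      ((fderiv_contract hx (hθ 1)).2 v)
  | succ k =>
    have he : formInChart (clifford x θ (k + 1)).1 c =ᶠ[𝓝 y]
        (fun z => contract (coordSection x c z).1 (formInChart (θ (k + 2)).1 c z)) +
          fun z => wedge (coordSection x c z).2 (formInChart (θ k).1 c z) := by
      filter_upwards [ht] with z hz
      exact congrFun (coordForm_clifford x hz θ) (k + 1)
    have h1 := fderiv_contract hx (hθ (k + 2))
    have h2 := fderiv_wedge hx (hθ k)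
    rw [fibreClifford_apply_succ, fibreClifford_apply_succ]
    refine (DFunLike.congr_fun (he.fderiv_eq.trans (fderiv_add h1.1 h2.1)) v).trans ?_
    refine (congrArg₂ (· + ·) (h1.2 v) (h2.2 v)).trans ?_
    exact add_add_add_comm _ _ _ _

/-- In a chart, `d = ∑ᵢ eⁱ ∧ ∂ᵢ`. -/
theorem coordForm_deRham {ι : Type*} [Fintype ι] {e : ι → E} {ξ : ι → E →L[ℝ] ℝ}
    (h : IsResolution e ξ) {c : M} {y : E} (hy : y ∈ (extChartAt 𝓘(ℝ, E) c).target)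
    (θ : Forms E M) :
    coordForm c y (deRham E M θ) =
      ∑ i, fibreClifford ((0, ξ i) : E × (E →L[ℝ] ℝ)) (coordDeriv c y (e i) θ) := by
  funext k
  rw [FibreForms.sum_apply]
  cases k with
  | zero =>
    refine Eq.trans ?_ (Finset.sum_eq_zero fun i _ => ?_).symm
    · rfl
    · rw [fibreClifford_apply_zero]
      ext m
      exact (coordDeriv c y (e i) θ 1).map_coord_zero 0 rfl
  | succ k =>
    refine (formInChart_extDerivAt (θ k) c hy).trans ?_
    ext m
    rw [extDeriv, ContinuousAlternatingMap.alternatizeUncurryFin_apply,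
      ContinuousAlternatingMap.sum_apply]
    have h0 : ∀ i, fibreClifford ((0, ξ i) : E × (E →L[ℝ] ℝ)) (coordDeriv c y (e i) θ) (k + 1) m =
        ∑ j : Fin (k + 1), (-1) ^ (j : ℕ) *
          (ξ i (m j) * fderiv ℝ (formInChart (θ k).1 c) y (e i) (j.removeNth m)) := fun i => by
      rw [fibreClifford_apply_succ, ContinuousAlternatingMap.add_apply, wedge_apply,
        show contract (0 : E) (coordDeriv c y (e i) θ (k + 2)) m = 0 from
          (coordDeriv c y (e i) θ (k + 2)).map_coord_zero 0 rfl, zero_add]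
      rfl
    rw [Finset.sum_congr rfl fun i _ => h0 i, Finset.sum_comm]
    refine Finset.sum_congr rfl fun j _ => ?_
    rw [← Finset.mul_sum]
    conv_lhs => rw [← h (m j)]
    simp [map_sum, ContinuousAlternatingMap.sum_apply]

/-- The Dorfman bracket `[[x, d], y]` of two sections acts pointwise as the Clifford action of an
element of `TM ⊕ T*M`. In a chart `[x, d] = ∂_X + ∑ᵢ eⁱ · ∂ᵢx`, and the bracket is
`∂_X y - ∂_Y x + ∑ᵢ 2⟨∂ᵢx, y⟩ eⁱ`. -/
theorem exists_dorfman_apply [FiniteDimensional ℝ E] (x y : GenSection E M) (p : M) :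
    ∃ s : GenTangent E p, ∀ θ : Forms E M,
      formAt p (((clifford x * deRham E M + deRham E M * clifford x) * clifford y -
        clifford y * (clifford x * deRham E M + deRham E M * clifford x)) θ) =
      fibreClifford s (formAt p θ) := by
  suffices H : ∀ z ∈ (extChartAt 𝓘(ℝ, E) p).target,
      ∃ s : GenTangent E ((extChartAt 𝓘(ℝ, E) p).symm z), ∀ θ : Forms E M,
        formAt ((extChartAt 𝓘(ℝ, E) p).symm z)
          (((clifford x * deRham E M + deRham E M * clifford x) * clifford y -
            clifford y * (clifford x * deRham E M + deRham E M * clifford x)) θ) =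
        fibreClifford s (formAt ((extChartAt 𝓘(ℝ, E) p).symm z) θ) by
    have := H (extChartAt 𝓘(ℝ, E) p p) (mem_extChartAt_target p)
    rwa [extChartAt_to_inv p] at this
  intro z hz
  let b := Module.finBasis ℝ E
  let e : Fin (Module.finrank ℝ E) → E := b
  let ξ : Fin (Module.finrank ℝ E) → E →L[ℝ] ℝ :=
    fun i => LinearMap.toContinuousLinearMap (b.coord i)
  have hres : IsResolution e ξ := fun v => b.sum_repr v
  set x₀ := coordSection x p z with hx₀
  set y₀ := coordSection y p z with hy₀
  let ε : Fin (Module.finrank ℝ E) → E × (E →L[ℝ] ℝ) := fun i => (0, ξ i)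
  let X : Fin (Module.finrank ℝ E) → E × (E →L[ℝ] ℝ) :=
    fun i => fderiv ℝ (coordSection x p) z (e i)
  let Y : Fin (Module.finrank ℝ E) → E × (E →L[ℝ] ℝ) :=
    fun i => fderiv ℝ (coordSection y p) z (e i)
  -- `[x, d]` is the first-order operator `∂_X + ∑ᵢ eⁱ · ∂ᵢx`
  have hu : ∀ θ : Forms E M,
      coordForm p z ((clifford x * deRham E M + deRham E M * clifford x) θ) =
        ∑ i, (ξ i x₀.1 • coordDeriv p z (e i) θ +
          (fibreClifford (ε i) * fibreClifford (X i)) (coordForm p z θ)) := by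
    intro θ
    have h1 : coordForm p z ((clifford x * deRham E M + deRham E M * clifford x) θ) =
        coordForm p z (clifford x (deRham E M θ)) + coordForm p z (deRham E M (clifford x θ)) :=
      rfl
    rw [h1, coordForm_clifford x hz, coordForm_deRham hres hz, coordForm_deRham hres hz, map_sum,
      ← Finset.sum_add_distrib]
    refine Finset.sum_congr rfl fun i _ => ?_
    rw [coordDeriv_clifford x hz, map_add]
    have h2 := LinearMap.congr_fun (fibreClifford_anticomm x₀ (ε i)) (coordDeriv p z (e i) θ)
    have h3 : x₀.2 (ε i).1 + (ε i).2 x₀.1 = ξ i x₀.1 := by simp [ε]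
    rw [h3] at h2
    have h4 : ξ i x₀.1 • coordDeriv p z (e i) θ =
        fibreClifford x₀ (fibreClifford (ε i) (coordDeriv p z (e i) θ)) +
          fibreClifford (ε i) (fibreClifford x₀ (coordDeriv p z (e i) θ)) := h2.symm
    rw [h4, Module.End.mul_apply]
    abel
  let s' : E × (E →L[ℝ] ℝ) := ∑ i, (ξ i x₀.1 • Y i + (((X i).2 y₀.1 + y₀.2 (X i).1) • ε i -
    ((ε i).2 y₀.1 + y₀.2 (ε i).1) • X i))
  have hD : ∀ θ : Forms E M,
      coordForm p z (((clifford x * deRham E M + deRham E M * clifford x) * clifford y -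
        clifford y * (clifford x * deRham E M + deRham E M * clifford x)) θ) =
      fibreClifford s' (coordForm p z θ) := by
    intro θ
    have h1 : coordForm p z (((clifford x * deRham E M + deRham E M * clifford x) * clifford y -
        clifford y * (clifford x * deRham E M + deRham E M * clifford x)) θ) =
        coordForm p z ((clifford x * deRham E M + deRham E M * clifford x) (clifford y θ)) -
        coordForm p z (clifford y ((clifford x * deRham E M + deRham E M * clifford x) θ)) :=
      rfl
    rw [h1, hu, coordForm_clifford y hz, coordForm_clifford y hz, hu, map_sum,
      ← Finset.sum_sub_distrib, map_sum, LinearMap.sum_apply]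
    refine Finset.sum_congr rfl fun i _ => ?_
    rw [coordDeriv_clifford y hz, map_add (fibreClifford y₀),
      map_smul (fibreClifford y₀), map_add, map_smul, map_sub, map_smul, map_smul,
      ← fibreClifford_mul_commutator]
    change ξ i x₀.1 • (fibreClifford (Y i) (coordForm p z θ) +
        fibreClifford y₀ (coordDeriv p z (e i) θ)) +
        fibreClifford (ε i) (fibreClifford (X i) (fibreClifford y₀ (coordForm p z θ))) -
      (ξ i x₀.1 • fibreClifford y₀ (coordDeriv p z (e i) θ) +
        fibreClifford y₀ (fibreClifford (ε i) (fibreClifford (X i) (coordForm p z θ)))) =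
      ξ i x₀.1 • fibreClifford (Y i) (coordForm p z θ) +
        (fibreClifford (ε i) (fibreClifford (X i) (fibreClifford y₀ (coordForm p z θ))) -
        fibreClifford y₀ (fibreClifford (ε i) (fibreClifford (X i) (coordForm p z θ))))
    rw [smul_add]
    abel
  refine ⟨(frame E p _ s'.1, s'.2.comp (coframe E p _)), fun θ => ?_⟩
  rw [formAt_eq_fibrePull hz, hD, formAt_eq_fibrePull hz θ, ← fibrePull_fibreClifford,
    coframe_frame (extChartAt_symm_mem hz)]

theorem exists_actsPointwise_dorfman [FiniteDimensional ℝ E] (x y : GenSection E M) :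
    ∃ s : ∀ p : M, GenTangent E p,
      ActsPointwise ((clifford x * deRham E M + deRham E M * clifford x) * clifford y -
        clifford y * (clifford x * deRham E M + deRham E M * clifford x))
        (fun p => fibreClifford (s p)) := by
  choose s hs using exists_dorfman_apply x y
  exact ⟨s, fun θ p => hs p θ⟩

end DeRham

/-! ### Polynomials in intertwined operators -/

section PolynomialOperators

open Polynomial

theorem aeval_apply_of_intertwine {V W : Type*} [AddCommGroup V] [Module ℝ V] [AddCommGroup W]
    [Module ℝ W] (f : V →ₗ[ℝ] W) {a : Module.End ℝ V} {b : Module.End ℝ W}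
    (h : ∀ v, f (a v) = b (f v)) (q : ℝ[X]) (v : V) : f (aeval a q v) = aeval b q (f v) := by
  have hpow : ∀ (n : ℕ) (v : V), f ((a ^ n) v) = (b ^ n) (f v) := by
    intro n
    induction n with
    | zero => intro v; rfl
    | succ n ih =>
      intro v
      rw [pow_succ, pow_succ, Module.End.mul_apply, Module.End.mul_apply, ih, h]
  induction q using Polynomial.induction_on' with
  | add p q hp hq => simp only [map_add, LinearMap.add_apply, hp, hq]
  | monomial n c =>
    rw [aeval_monomial, aeval_monomial, Module.End.mul_apply, Module.End.mul_apply,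
      Module.algebraMap_end_apply, Module.algebraMap_end_apply, map_smul, hpow]

theorem aeval_apply_mem {V : Type*} [AddCommGroup V] [Module ℝ V] {a : Module.End ℝ V}
    {N : Submodule ℝ V} (h : ∀ v ∈ N, a v ∈ N) (q : ℝ[X]) {v : V} (hv : v ∈ N) :
    aeval a q v ∈ N := by
  have := aeval_apply_of_intertwine N.subtype (a := a.restrict h) (b := a) (fun _ => rfl) q ⟨v, hv⟩
  rw [← show N.subtype ⟨v, hv⟩ = v from rfl, ← this]
  exact Subtype.property _

/-- Polynomials commute with antihomomorphisms, since the powers of one element commute. -/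
theorem aeval_eq_of_antihom {A B : Type*} [Ring A] [Algebra ℝ A] [Ring B] [Algebra ℝ B]
    (F : A →ₗ[ℝ] B) (h1 : F 1 = 1) (hmul : ∀ x y, F (x * y) = F y * F x) (a : A) (q : ℝ[X]) :
    aeval (F a) q = F (aeval a q) := by
  have hpow : ∀ n : ℕ, F a ^ n = F (a ^ n) := by
    intro n
    induction n with
    | zero => simp [h1]
    | succ n ih => rw [pow_succ', pow_succ, hmul, ih]
  induction q using Polynomial.induction_on' with
  | add p q hp hq => simp only [map_add, hp, hq]
  | monomial n c =>
    rw [aeval_monomial, aeval_monomial, hpow, ← Algebra.smul_def, ← Algebra.smul_def, map_smul]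

end PolynomialOperators

/-! ### The trilinear torsion -/

section Trilinear

open Polynomial

variable {Γ B : Type*} [AddCommGroup Γ] [Module ℝ Γ] [Ring B] [Algebra ℝ B]

/-- The anticommutator `u ↦ (x ↦ u c(x) + c(x) u)`. -/
def anticommutator (c : Γ →ₗ[ℝ] B) : B →ₗ[ℝ] Γ →ₗ[ℝ] B :=
  (LinearMap.mul ℝ B + (LinearMap.mul ℝ B).flip).compl₂ c

/-- The commutator `u ↦ (x ↦ u c(x) - c(x) u)`. -/
def commutator (c : Γ →ₗ[ℝ] B) : B →ₗ[ℝ] Γ →ₗ[ℝ] B :=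
  (LinearMap.mul ℝ B - (LinearMap.mul ℝ B).flip).compl₂ c

theorem anticommutator_apply (c : Γ →ₗ[ℝ] B) (u : B) (x : Γ) :
    anticommutator c u x = u * c x + c x * u := rfl

theorem commutator_apply (c : Γ →ₗ[ℝ] B) (u : B) (x : Γ) :
    commutator c u x = u * c x - c x * u := rfl

variable (Γ B) in
/-- The trilinear maps on `Γ` with values in `B`, among all functions of three arguments. -/
def trilinearSubmodule : Submodule ℝ (Γ → Γ → Γ → B) where
  carrier := {t | (∀ y z, IsLinearMap ℝ fun x => t x y z) ∧
    (∀ x z, IsLinearMap ℝ fun y => t x y z) ∧ ∀ x y, IsLinearMap ℝ fun z => t x y z}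
  add_mem' := fun hs ht =>
    ⟨fun y z => ((hs.1 y z).mk' _ + (ht.1 y z).mk' _).isLinear,
      fun x z => ((hs.2.1 x z).mk' _ + (ht.2.1 x z).mk' _).isLinear,
      fun x y => ((hs.2.2 x y).mk' _ + (ht.2.2 x y).mk' _).isLinear⟩
  zero_mem' := ⟨fun _ _ => (0 : Γ →ₗ[ℝ] B).isLinear, fun _ _ => (0 : Γ →ₗ[ℝ] B).isLinear,
    fun _ _ => (0 : Γ →ₗ[ℝ] B).isLinear⟩
  smul_mem' := fun r _ ht =>
    ⟨fun y z => (r • (ht.1 y z).mk' _).isLinear,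
      fun x z => (r • (ht.2.1 x z).mk' _).isLinear,
      fun x y => (r • (ht.2.2 x y).mk' _).isLinear⟩

variable (Γ B) in
/-- The space of trilinear maps on `Γ` with values in `B`. -/
def Trilinear : Type _ := trilinearSubmodule Γ B

instance : AddCommGroup (Trilinear Γ B) := inferInstanceAs (AddCommGroup (trilinearSubmodule Γ B))

instance : Module ℝ (Trilinear Γ B) := inferInstanceAs (Module ℝ (trilinearSubmodule Γ B))

/-- The value of a trilinear map. -/
def Trilinear.eval (t : Trilinear Γ B) (x y z : Γ) : B := t.1 x y z

theorem Trilinear.ext {s t : Trilinear Γ B} (h : ∀ x y z, s.eval x y z = t.eval x y z) : s = t :=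
  Subtype.ext (funext fun x => funext fun y => funext fun z => h x y z)

/-- The trilinear torsion `(x, y, z) ↦ [[[x, δ], y], z]` for odd `x, y, z, δ`. -/
def torsion (c : Γ →ₗ[ℝ] B) : B →ₗ[ℝ] Trilinear Γ B where
  toFun δ := ⟨fun x y z => anticommutator c (commutator c (anticommutator c δ x) y) z,
    fun y z => ⟨fun _ _ => by simp, fun _ _ => by simp⟩,
    fun x z => ⟨fun _ _ => by simp, fun _ _ => by simp⟩,
    fun x y => ⟨fun _ _ => by simp, fun _ _ => by simp⟩⟩
  map_add' δ ε := Trilinear.ext fun x y z => by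
    change anticommutator c (commutator c (anticommutator c (δ + ε) x) y) z =
      anticommutator c (commutator c (anticommutator c δ x) y) z +
        anticommutator c (commutator c (anticommutator c ε x) y) z
    simp
  map_smul' r δ := Trilinear.ext fun x y z => by
    change anticommutator c (commutator c (anticommutator c (r • δ) x) y) z =
      r • anticommutator c (commutator c (anticommutator c δ x) y) z
    simp

theorem torsion_eval (c : Γ →ₗ[ℝ] B) (δ : B) (x y z : Γ) : (torsion c δ).eval x y z =
    ((δ * c x + c x * δ) * c y - c y * (δ * c x + c x * δ)) * c z +
      c z * ((δ * c x + c x * δ) * c y - c y * (δ * c x + c x * δ)) := rfl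

variable (Γ B) in
/-- Precomposition of a trilinear map with an endomorphism in its `i`-th argument. -/
def slot : Fin 3 → Module.End ℝ Γ →ₗ[ℝ] Module.End ℝ (Trilinear Γ B) :=
  ![LinearMap.mk₂ ℝ (fun a t => ⟨fun x y z => t.1 (a x) y z,
        fun y z => ((t.2.1 y z).mk' _ ∘ₗ a).isLinear, fun x z => t.2.2.1 (a x) z,
        fun x y => t.2.2.2 (a x) y⟩)
      (fun _ _ t => Trilinear.ext fun _ y z => (t.2.1 y z).map_add _ _)
      (fun _ _ t => Trilinear.ext fun _ y z => (t.2.1 y z).map_smul _ _)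
      (fun _ _ _ => rfl) (fun _ _ _ => rfl),
    LinearMap.mk₂ ℝ (fun a t => ⟨fun x y z => t.1 x (a y) z,
        fun y z => t.2.1 (a y) z, fun x z => ((t.2.2.1 x z).mk' _ ∘ₗ a).isLinear,
        fun x y => t.2.2.2 x (a y)⟩)
      (fun _ _ t => Trilinear.ext fun x _ z => (t.2.2.1 x z).map_add _ _)
      (fun _ _ t => Trilinear.ext fun x _ z => (t.2.2.1 x z).map_smul _ _)
      (fun _ _ _ => rfl) (fun _ _ _ => rfl),
    LinearMap.mk₂ ℝ (fun a t => ⟨fun x y z => t.1 x y (a z),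
        fun y z => t.2.1 y (a z), fun x z => t.2.2.1 x (a z),
        fun x y => ((t.2.2.2 x y).mk' _ ∘ₗ a).isLinear⟩)
      (fun _ _ t => Trilinear.ext fun x y _ => (t.2.2.2 x y).map_add _ _)
      (fun _ _ t => Trilinear.ext fun x y _ => (t.2.2.2 x y).map_smul _ _)
      (fun _ _ _ => rfl) (fun _ _ _ => rfl)]

theorem aeval_slot (i : Fin 3) (a : Module.End ℝ Γ) (q : ℝ[X]) :
    aeval (slot Γ B i a) q = slot Γ B i (aeval a q) := by
  refine aeval_eq_of_antihom (slot Γ B i) ?_ (fun x y => ?_) a q <;> fin_cases i <;> rfl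

theorem slot_commute (a : Module.End ℝ Γ) (i j : Fin 3) :
    Commute (slot Γ B i a) (slot Γ B j a) := by
  fin_cases i <;> fin_cases j <;> rfl

/-- Postcomposition of a trilinear map with an endomorphism of its target. -/
def postcomp (D : Module.End ℝ B) : Module.End ℝ (Trilinear Γ B) where
  toFun t := ⟨fun x y z => D (t.1 x y z), fun y z => (D ∘ₗ (t.2.1 y z).mk' _).isLinear,
    fun x z => (D ∘ₗ (t.2.2.1 x z).mk' _).isLinear, fun x y => (D ∘ₗ (t.2.2.2 x y).mk' _).isLinear⟩
  map_add' _ _ := Trilinear.ext fun _ _ _ => map_add D _ _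
  map_smul' _ _ := Trilinear.ext fun _ _ _ => map_smul D _ _

/-- The inner derivation `[Φ, ·]`. -/
def innerDerivation (Φ : B) : Module.End ℝ B := LinearMap.mulLeft ℝ Φ - LinearMap.mulRight ℝ Φ

theorem innerDerivation_apply (Φ χ : B) : innerDerivation Φ χ = Φ * χ - χ * Φ := rfl

/-- The Jacobi identity for the torsion. -/
theorem torsion_innerDerivation {c : Γ →ₗ[ℝ] B} {Φ : B} {a : Module.End ℝ Γ}
    (h : ∀ x, Φ * c x - c x * Φ = c (a x)) (δ : B) :
    torsion c (innerDerivation Φ δ) = (postcomp (innerDerivation Φ) +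
      -(slot Γ B 0 a + slot Γ B 1 a + slot Γ B 2 a) : Module.End ℝ (Trilinear Γ B))
        (torsion c δ) := by
  refine Trilinear.ext fun x y z => ?_
  change _ = innerDerivation Φ ((torsion c δ).eval x y z) + -((torsion c δ).eval (a x) y z +
    (torsion c δ).eval x (a y) z + (torsion c δ).eval x y (a z))
  simp only [torsion_eval, ← h, innerDerivation_apply]
  noncomm_ring

/-- If `[Φ, ·]` acts on `Γ` as `a` and annihilates the values of the torsion of `δ`, then the
torsion of `Q([Φ, ·]) δ` is the action of `Q(-(a ⊗ 1 ⊗ 1 + 1 ⊗ a ⊗ 1 + 1 ⊗ 1 ⊗ a))` on the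
torsion of `δ`. -/
theorem torsion_aeval {c : Γ →ₗ[ℝ] B} {Φ : B} {a : Module.End ℝ Γ}
    (h : ∀ x, Φ * c x - c x * Φ = c (a x)) {δ : B}
    (h0 : ∀ x y z, Φ * (torsion c δ).eval x y z - (torsion c δ).eval x y z * Φ = 0) (Q : ℝ[X]) :
    torsion c (aeval (innerDerivation Φ) Q δ) =
      aeval (-(slot Γ B 0 a + slot Γ B 1 a + slot Γ B 2 a)) Q (torsion c δ) := by
  rw [aeval_apply_of_intertwine (torsion c) (torsion_innerDerivation h) Q δ]
  -- on `N`, which `S` preserves, the operators `postcomp (innerDerivation Φ) - S` and `-S` agree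
  let S := slot Γ B 0 a + slot Γ B 1 a + slot Γ B 2 a
  let N := LinearMap.ker (postcomp (Γ := Γ) (innerDerivation Φ))
  have hN : torsion c δ ∈ N := LinearMap.mem_ker.2 (Trilinear.ext h0)
  have hinv : ∀ t ∈ N, (-S) t ∈ N := by
    intro t ht
    replace ht : ∀ x y z, innerDerivation Φ (t.eval x y z) = 0 := fun x y z =>
      congrArg (fun s : Trilinear Γ B => s.eval x y z) (LinearMap.mem_ker.1 ht)
    refine LinearMap.mem_ker.2 (Trilinear.ext fun x y z => ?_)
    change innerDerivation Φ (-(t.eval (a x) y z + t.eval x (a y) z + t.eval x y (a z))) = 0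
    rw [map_neg, map_add, map_add, ht, ht, ht, add_zero, add_zero, neg_zero]
  have e1 := aeval_apply_of_intertwine N.subtype (a := (-S).restrict hinv)
    (b := (postcomp (innerDerivation Φ) + -S : Module.End ℝ (Trilinear Γ B))) (fun t => by
      have ht : postcomp (innerDerivation Φ) t.1 = 0 := LinearMap.mem_ker.1 t.2
      change (-S) t.1 = postcomp (innerDerivation Φ) t.1 + (-S) t.1
      rw [ht, zero_add]) Q ⟨_, hN⟩
  have e2 := aeval_apply_of_intertwine N.subtype (a := (-S).restrict hinv)
    (b := -S) (fun _ => rfl) Q ⟨_, hN⟩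
  exact e1.symm.trans e2

/-- Vanishing of the torsion of `P([Φ, ·]) δ` passes to the semisimple and to the nilpotent part. -/
theorem torsion_aeval_eq_zero {P q r Q : ℝ[X]} (hJ : IsJordanChevalleyPolynomial P q)
    (hP : P.Monic) (hr : r = q ∨ r = X - q) (hQ : P ∣ Q.comp r)
    {c : Γ →ₗ[ℝ] B} {a : Module.End ℝ Γ} (ha : aeval a P = 0) {δ Φ Ψ : B}
    (hΦ : ∀ x, Φ * c x - c x * Φ = c (a x))
    (hΦ0 : ∀ x y z, Φ * (torsion c δ).eval x y z - (torsion c δ).eval x y z * Φ = 0)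
    (hΨ : ∀ x, Ψ * c x - c x * Ψ = c (aeval a r x))
    (hΨ0 : ∀ x y z, Ψ * (torsion c δ).eval x y z - (torsion c δ).eval x y z * Ψ = 0)
    (h : torsion c (aeval (innerDerivation Φ) P δ) = 0) :
    torsion c (aeval (innerDerivation Ψ) Q δ) = 0 := by
  rw [torsion_aeval hΦ hΦ0] at h
  rw [torsion_aeval hΨ hΨ0, ← aeval_slot, ← aeval_slot, ← aeval_slot]
  exact hJ.aeval_neg_add_apply hP (a := fun i => slot Γ B i a) (slot_commute a)
    (fun i => by rw [aeval_slot, ha, map_zero]) h hr hQ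

end Trilinear

/-! ### Parity of operators -/

section Parity

variable {E : Type*} [NormedAddCommGroup E] [NormedSpace ℝ E]
  {M : Type*} [TopologicalSpace M] [ChartedSpace E M] [IsManifold 𝓘(ℝ, E) ∞ M]

theorem parity_mul_self : parity E M * parity E M = 1 :=
  (actsPointwise_parity.mul actsPointwise_parity).unique fun θ p => by
    change formAt p θ =
      (fibreParity * fibreParity : Module.End ℝ (FibreForms (TangentSpace 𝓘(ℝ, E) p))) (formAt p θ)
    rw [fibreParity_mul_self]; rfl

theorem parityConj_apply (Ψ : Operator E M) : parityConj Ψ = parity E M * (Ψ * parity E M) := rfl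

theorem parityConj_mul (Ψ Χ : Operator E M) : parityConj (Ψ * Χ) = parityConj Ψ * parityConj Χ := by
  simp only [parityConj_apply]
  calc parity E M * (Ψ * Χ * parity E M) = parity E M * Ψ * 1 * Χ * parity E M := by
        simp only [mul_one, mul_assoc]
    _ = _ := by rw [← parity_mul_self]; simp only [mul_assoc]

theorem parityConj_clifford (x : GenSection E M) : parityConj (clifford x) = -clifford x := by
  have h : parity E M * clifford x = -1 * (clifford x * parity E M) := by
    rw [neg_one_mul, ← sub_eq_zero, sub_neg_eq_add]
    refine ((actsPointwise_parity.mul (actsPointwise_clifford x)).add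
      ((actsPointwise_clifford x).mul actsPointwise_parity)).unique
        (ActsPointwise.zero.congr fun p => ?_)
    rw [fibreParity_mul_fibreClifford]
    simp
  rw [parityConj_apply, ← mul_assoc, h, mul_assoc, mul_assoc, parity_mul_self, mul_one,
    neg_one_mul]

theorem parityConj_deRham : parityConj (deRham E M) = -deRham E M := by
  refine LinearMap.ext fun θ => funext fun k => ?_
  cases k with
  | zero =>
    change (-1 : ℝ) ^ 0 • (0 : SmoothForm E M 0) = -0
    rw [smul_zero]
    exact (neg_zero (G := SmoothForm E M 0)).symm
  | succ k =>
    change (-1 : ℝ) ^ (k + 1) • deRham E M (fun j => (-1 : ℝ) ^ j • θ j) (k + 1) =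
      -deRham E M θ (k + 1)
    refine Subtype.ext ?_
    change (-1 : ℝ) ^ (k + 1) • extDerivAt ((-1 : ℝ) ^ k • θ k).1 = -extDerivAt (θ k).1
    rw [extDerivAt_smul, smul_smul, ← pow_add, ← neg_one_smul ℝ (extDerivAt (θ k).1)]
    congr 1
    rw [Odd.neg_one_pow ⟨k, by ring⟩]

theorem ad_eq_innerDerivation {Φ : Operator E M} (hΦ : parityConj Φ = Φ) :
    ad Φ = innerDerivation Φ := LinearMap.ext (ad_apply_of_even hΦ)

theorem derivedBracket_of_odd {δ ψ : Operator E M} (hδ : parityConj δ = -δ)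
    (hψ : parityConj ψ = -ψ) (χ : Operator E M) : derivedBracket δ ψ χ =
      (δ * ψ + ψ * δ) * χ - χ * (δ * ψ + ψ * δ) := by
  have h1 : evenPart ψ = 0 := by rw [evenPart, hψ, add_neg_cancel, smul_zero]
  have h2 : oddPart ψ = ψ := by
    rw [oddPart, hψ, sub_neg_eq_add, ← two_smul ℝ ψ, smul_smul]; norm_num
  have h3 : ad ψ δ = δ * ψ + ψ * δ := by
    simp [ad, h1, h2, hδ, add_comm]
  rw [derivedBracket, h3, ad_apply_of_even]
  rw [map_add, parityConj_mul, parityConj_mul, hδ, hψ, neg_mul_neg, neg_mul_neg]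

/-- The minimal operator of an even operator is odd. -/
theorem parityConj_minimalOperator {Φ : Operator E M} (hΦ : parityConj Φ = Φ)
    (Q : Polynomial ℝ) : parityConj (minimalOperator Q Φ) = -minimalOperator Q Φ := by
  let N : Submodule ℝ (Operator E M) := LinearMap.ker (parityConj + LinearMap.id)
  have hN : ∀ δ, δ ∈ N ↔ parityConj δ = -δ := fun δ => by
    rw [LinearMap.mem_ker, LinearMap.add_apply, LinearMap.id_apply, add_eq_zero_iff_eq_neg]
  refine (hN _).1 (aeval_apply_mem (fun δ hδ => (hN _).2 ?_) Q ((hN _).2 parityConj_deRham))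
  rw [hN] at hδ
  rw [ad_apply_of_even hΦ, map_sub, parityConj_mul, parityConj_mul, hΦ, hδ]
  noncomm_ring

end Parity

/-! ### The Clifford action of the space of sections -/

section CliffordSections

variable {E : Type*} [NormedAddCommGroup E] [NormedSpace ℝ E]
  {M : Type*} [TopologicalSpace M] [ChartedSpace E M] [IsManifold 𝓘(ℝ, E) ∞ M]

theorem actsPointwise_clifford_toGenSection (s : Sections E M) :
    ActsPointwise (clifford (toGenSection s)) (fun p => fibreClifford (sectionAt p s)) := by
  simpa only [toGenSection_toFun] using actsPointwise_clifford (toGenSection s)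

/-- The action of sections of `TM ⊕ T*M` on forms, as a linear map. -/
def cliffordSections : Sections E M →ₗ[ℝ] Operator E M where
  toFun s := clifford (toGenSection s)
  map_add' s t := (actsPointwise_clifford_toGenSection (s + t)).unique
    (((actsPointwise_clifford_toGenSection s).add (actsPointwise_clifford_toGenSection t)).congr
      fun p => (map_add fibreClifford (sectionAt p s) (sectionAt p t)).symm)
  map_smul' r s := (actsPointwise_clifford_toGenSection (r • s)).unique
    (((actsPointwise_clifford_toGenSection s).smul r).congr
      fun p => (map_smul fibreClifford r (sectionAt p s)).symm)

theorem actsPointwise_cliffordSections (s : Sections E M) :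
    ActsPointwise (cliffordSections s) (fun p => fibreClifford (sectionAt p s)) :=
  actsPointwise_clifford_toGenSection s

/-- A `GenSection` as an element of `Sections E M`. -/
def ofGenSection (x : GenSection E M) : Sections E M := ⟨x.toFun, x, rfl⟩

theorem cliffordSections_ofGenSection (x : GenSection E M) :
    cliffordSections (ofGenSection x) = clifford x :=
  (actsPointwise_cliffordSections _).unique (actsPointwise_clifford x)

variable {A : ∀ p : M, Module.End ℝ (GenTangent E p)}

/-- The endomorphism of the space of sections induced by an endomorphism field. -/
def fieldEnd (hA : ∀ x : GenSection E M, ∃ y : GenSection E M, ∀ p, y.toFun p = A p (x.toFun p)) :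
    Module.End ℝ (Sections E M) where
  toFun s := ⟨fun p => A p (sectionAt p s), by
    obtain ⟨y, hy⟩ := hA (toGenSection s)
    exact ⟨y, funext fun p => by rw [hy, toGenSection_toFun]⟩⟩
  map_add' s t := Subtype.ext (funext fun p => map_add (A p) (sectionAt p s) (sectionAt p t))
  map_smul' r s := Subtype.ext (funext fun p => map_smul (A p) r (sectionAt p s))

variable (hA : ∀ x : GenSection E M, ∃ y : GenSection E M, ∀ p, y.toFun p = A p (x.toFun p))

theorem aeval_fieldEnd_apply (q : Polynomial ℝ) (s : Sections E M) (p : M) :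
    sectionAt p (Polynomial.aeval (fieldEnd hA) q s) = Polynomial.aeval (A p) q (sectionAt p s) :=
  aeval_apply_of_intertwine (sectionAt p) (a := fieldEnd hA)
    (b := A p) (fun _ => rfl) q s

theorem commutator_cliffordSections {Φ : Operator E M} (h : IsLift A Φ) (s : Sections E M) :
    Φ * cliffordSections s - cliffordSections s * Φ = cliffordSections (fieldEnd hA s) := by
  rw [← ad_apply_of_even h.even]
  refine h.comm_section _ _ fun p => ?_
  rw [toGenSection_toFun, toGenSection_toFun]
  rfl

include hA in
theorem exists_genSection_aeval (q : Polynomial ℝ) (x : GenSection E M) :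
    ∃ y : GenSection E M, ∀ p, y.toFun p = Polynomial.aeval (A p) q (x.toFun p) :=
  ⟨toGenSection (Polynomial.aeval (fieldEnd hA) q (ofGenSection x)), fun p => by
    rw [toGenSection_toFun]; exact aeval_fieldEnd_apply hA q (ofGenSection x) p⟩

end CliffordSections

/-! ### Polynomials in skew endomorphisms -/

section Skew

variable {V : Type*} [AddCommGroup V] [Module ℝ V]

/-- If `g` is adjoint to `f` for a bilinear form, then so is `q(g)` to `q(f)`. -/
theorem aeval_adjoint {β : V →ₗ[ℝ] Module.Dual ℝ V} {f g : Module.End ℝ V}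
    (h : ∀ x y, β (g y) x = β y (f x)) (q : Polynomial ℝ) (x y : V) :
    β (Polynomial.aeval g q y) x = β y (Polynomial.aeval f q x) := by
  have hpow : ∀ (n : ℕ) (y : V), β ((g ^ n) y) x = β y ((f ^ n) x) := by
    intro n
    induction n with
    | zero => intro y; rfl
    | succ n ih =>
      intro y
      rw [pow_succ, pow_succ', Module.End.mul_apply, Module.End.mul_apply, ih, h]
  induction q using Polynomial.induction_on' with
  | add p q hp hq => simp only [map_add, LinearMap.add_apply, hp, hq]
  | monomial n c =>
    simp only [Polynomial.aeval_monomial, Module.End.mul_apply, Module.algebraMap_end_apply,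
      map_smul, LinearMap.smul_apply, hpow]

/-- If `f` is skew for a nondegenerate form, then so are its semisimple and nilpotent parts. -/
theorem IsJordanChevalleyPolynomial.skew [FiniteDimensional ℝ V] {β : V →ₗ[ℝ] Module.Dual ℝ V}
    (hβ : ∀ y, (∀ x, β y x = 0) → y = 0) {f : Module.End ℝ V}
    (hf : ∀ x y, β y (f x) + β (f y) x = 0) {P q : Polynomial ℝ}
    (h : IsJordanChevalleyPolynomial P q) (hP : Polynomial.aeval f P = 0) {r : Polynomial ℝ}
    (hr : r = q ∨ r = Polynomial.X - q) (x y : V) :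
    β y (Polynomial.aeval f r x) + β (Polynomial.aeval f r y) x = 0 := by
  have hadj : ∀ x y, β ((-f) y) x = β y (f x) := fun x y => by
    rw [LinearMap.neg_apply, map_neg, LinearMap.neg_apply, neg_eq_iff_add_eq_zero, add_comm]
    exact hf x y
  have hP' : Polynomial.aeval (-f) P = 0 := LinearMap.ext fun y => hβ _ fun x => by
    rw [aeval_adjoint hadj, hP, LinearMap.zero_apply, map_zero]
  -- both sides are the semisimple part of `-f`
  have hq : Polynomial.aeval (-f) q = -Polynomial.aeval f q := by
    rw [← h.semisimplePart_eq hP']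
    refine semisimplePart_eq_of_isSemisimple
      (Module.End.isSemisimple_neg.2 (h.isSemisimple hP)) ?_ ?_
    · rw [neg_sub_neg, ← neg_sub]
      exact (h.isNilpotent hP).neg
    · refine (Commute.neg_right ?_).neg_left
      simpa using Commute.map ((Commute.all Polynomial.X q)) (Polynomial.aeval f)
  have hr' : Polynomial.aeval (-f) r = -Polynomial.aeval f r := by
    rcases hr with rfl | rfl
    · exact hq
    · rw [map_sub, map_sub, hq, Polynomial.aeval_X, Polynomial.aeval_X]; abel
  rw [← aeval_adjoint hadj r x y, hr', LinearMap.neg_apply, map_neg, LinearMap.neg_apply,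
    neg_add_cancel]

end Skew

/-! ### Brackets and torsion of operators on forms -/

section Torsion

variable {E : Type*} [NormedAddCommGroup E] [NormedSpace ℝ E]
  {M : Type*} [TopologicalSpace M] [ChartedSpace E M] [IsManifold 𝓘(ℝ, E) ∞ M]

/-- A function that acts on smooth forms is smooth: apply the operator to the form `1`. -/
theorem contMDiff_of_actsPointwise_smul_one {Ψ : Operator E M} {g : M → ℝ}
    (h : ActsPointwise Ψ (fun p => g p • 1)) : ContMDiff 𝓘(ℝ, E) 𝓘(ℝ, ℝ) ∞ g := by
  let η : SmoothForm E M 0 := Ψ (oneForm E M) 0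
  have hη : ∀ c y, formInChart η.1 c y ![] = g ((extChartAt 𝓘(ℝ, E) c).symm y) := fun c y => by
    have h1 : η.1 ((extChartAt 𝓘(ℝ, E) c).symm y) = _ := congrFun (h (oneForm E M) _) 0
    unfold formInChart
    rw [h1]
    exact mul_one _
  intro p
  have ht := (isOpen_extChartAt_target (I := 𝓘(ℝ, E)) p).mem_nhds (mem_extChartAt_target p)
  have h1 : ContDiffAt ℝ ∞ (fun y => formInChart η.1 p y ![]) (extChartAt 𝓘(ℝ, E) p p) :=
    (ContinuousAlternatingMap.apply ℝ E ℝ ![]).contDiff.contDiffAt.comp _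
      ((η.2 p).contDiffAt ht)
  refine (h1.contMDiffAt.comp p contMDiffAt_extChartAt).congr_of_eventuallyEq ?_
  filter_upwards [extChartAt_source_mem_nhds (I := 𝓘(ℝ, E)) p] with z hz
  rw [Function.comp_apply, hη, (extChartAt 𝓘(ℝ, E) p).left_inv hz]

variable [FiniteDimensional ℝ E]

/-- The Dorfman bracket of two elements of `Sections E M` acts pointwise. -/
theorem exists_actsPointwise_dorfmanSections (x y : Sections E M) :
    ∃ s : ∀ p : M, GenTangent E p,
      ActsPointwise (commutator cliffordSections
        (anticommutator cliffordSections (deRham E M) x) y) (fun p => fibreClifford (s p)) := by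
  obtain ⟨s, hs⟩ := exists_actsPointwise_dorfman (toGenSection x) (toGenSection y)
  rw [add_comm (_ * _)] at hs
  exact ⟨s, hs⟩

/-- The torsion of the de Rham operator takes values in multiplications by smooth functions. -/
theorem exists_torsion_deRham_eq_mulFun (x y z : Sections E M) :
    ∃ f, (torsion cliffordSections (deRham E M)).eval x y z = mulFun f := by
  obtain ⟨s, hs⟩ := exists_actsPointwise_dorfmanSections x y
  have h : ActsPointwise ((torsion cliffordSections (deRham E M)).eval x y z) _ :=
    ((hs.mul (actsPointwise_cliffordSections z)).add
      ((actsPointwise_cliffordSections z).mul hs)).congr fun p => fibreClifford_anticomm _ _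
  exact ⟨⟨_, contMDiff_of_actsPointwise_smul_one h⟩, h.unique (actsPointwise_mulFun _)⟩

theorem IsLift.commutator_torsion_deRham {A : ∀ p : M, Module.End ℝ (GenTangent E p)}
    {Φ : Operator E M} (h : IsLift A Φ) (x y z : Sections E M) :
    Φ * (torsion cliffordSections (deRham E M)).eval x y z -
      (torsion cliffordSections (deRham E M)).eval x y z * Φ = 0 := by
  obtain ⟨f, hf⟩ := exists_torsion_deRham_eq_mulFun x y z
  rw [hf, ← ad_apply_of_even h.even, h.comm_fun]

variable (E M) in
/-- The operators `δ` for which the brackets `[[x, δ], y]` of sections act as families of elements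
of the fibres of `TM ⊕ T*M`. -/
def bracketOperators : Submodule ℝ (Operator E M) where
  carrier := {δ | ∀ x y : Sections E M, ∃ s : ∀ p : M, GenTangent E p,
    ActsPointwise (commutator cliffordSections (anticommutator cliffordSections δ x) y)
      (fun p => fibreClifford (s p))}
  add_mem' {δ ε} hδ hε x y := by
    obtain ⟨s, hs⟩ := hδ x y
    obtain ⟨t, ht⟩ := hε x y
    refine ⟨fun p => s p + t p, ?_⟩
    rw [map_add, LinearMap.add_apply, map_add, LinearMap.add_apply]
    exact (hs.add ht).congr fun p => (map_add fibreClifford (s p) (t p)).symm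
  zero_mem' x y := ⟨fun _ => 0, by
    rw [map_zero, LinearMap.zero_apply, map_zero, LinearMap.zero_apply]
    exact ActsPointwise.zero.congr fun _ => (map_zero fibreClifford).symm⟩
  smul_mem' r δ hδ x y := by
    obtain ⟨s, hs⟩ := hδ x y
    refine ⟨fun p => r • s p, ?_⟩
    rw [map_smul, LinearMap.smul_apply, map_smul, LinearMap.smul_apply]
    exact (hs.smul r).congr fun p => (map_smul fibreClifford r (s p)).symm

variable [T2Space M] {A : ∀ p : M, Module.End ℝ (GenTangent E p)}

theorem innerDerivation_liftOp_mem (hA : IsSkewEndomorphism A) {δ : Operator E M}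
    (hδ : δ ∈ bracketOperators E M) : innerDerivation (liftOp hA) δ ∈ bracketOperators E M := by
  intro x y
  obtain ⟨s, hs⟩ := hδ x y
  obtain ⟨t, ht⟩ := hδ (fieldEnd hA.smooth x) y
  obtain ⟨u, hu⟩ := hδ x (fieldEnd hA.smooth y)
  have hc := commutator_cliffordSections hA.smooth (isLift_liftOp hA)
  have e : commutator cliffordSections
      (anticommutator cliffordSections (innerDerivation (liftOp hA) δ) x) y =
      liftOp hA * commutator cliffordSections (anticommutator cliffordSections δ x) y -
        commutator cliffordSections (anticommutator cliffordSections δ x) y * liftOp hA -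
        commutator cliffordSections (anticommutator cliffordSections δ
          (fieldEnd hA.smooth x)) y -
        commutator cliffordSections (anticommutator cliffordSections δ x)
          (fieldEnd hA.smooth y) := by
    simp only [commutator_apply, anticommutator_apply, ← hc, innerDerivation_apply]
    noncomm_ring
  refine ⟨fun p => A p (s p) - t p - u p, ?_⟩
  rw [e]
  refine (((((actsPointwise_liftOp hA).mul hs).sub (hs.mul (actsPointwise_liftOp hA))).sub
    ht).sub hu).congr fun p => ?_
  rw [liftAt_commutator hA, ← map_sub, ← map_sub]

/-- The minimal torsion vanishes as soon as its pairings with sections do. -/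
theorem derivedBracket_eq_zero_of_torsion_eq_zero (hA : IsSkewEndomorphism A) {Q : Polynomial ℝ}
    (h : torsion cliffordSections (minimalOperator Q (liftOp hA)) = 0) (x y : GenSection E M) :
    derivedBracket (minimalOperator Q (liftOp hA)) (clifford x) (clifford y) = 0 := by
  have hmem : minimalOperator Q (liftOp hA) ∈ bracketOperators E M := by
    rw [minimalOperator, ad_eq_innerDerivation (parityConj_liftOp hA)]
    exact aeval_apply_mem (fun δ => innerDerivation_liftOp_mem hA) Q
      exists_actsPointwise_dorfmanSections
  rw [derivedBracket_of_odd (parityConj_minimalOperator (parityConj_liftOp hA) Q)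
    (parityConj_clifford x)]
  obtain ⟨s, hs⟩ := hmem (ofGenSection x) (ofGenSection y)
  rw [commutator_apply, anticommutator_apply, cliffordSections_ofGenSection,
    cliffordSections_ofGenSection] at hs
  refine hs.unique (ActsPointwise.zero.congr fun p => ?_)
  rw [eq_zero_of_pairing_eq_zero (s := s p) fun z => ?_, map_zero]
  have h0 := congrArg (fun t => t.eval (ofGenSection x) (ofGenSection y) (ofGenSection z)) h
  simp only [torsion_eval, cliffordSections_ofGenSection] at h0
  have h1 := (((hs.mul (actsPointwise_clifford z)).add ((actsPointwise_clifford z).mul hs)).congr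
    fun p => fibreClifford_anticomm _ _) (oneForm E M) p
  rw [h0, formAt_oneForm] at h1
  -- `h1` says that multiplication by the pairing annihilates the form `1`
  have h2 := congrArg (fun θ => θ ![]) (congrFun h1 0)
  exact ((h2.trans (mul_one _)).symm : _)

end Torsion

/-! ### Polynomials in a minimal structure -/

section Minimal

open Polynomial

variable {E : Type*} [NormedAddCommGroup E] [NormedSpace ℝ E] [FiniteDimensional ℝ E]
  {M : Type*} [TopologicalSpace M] [T2Space M] [ChartedSpace E M] [IsManifold 𝓘(ℝ, E) ∞ M]

variable (E) in
/-- The duality pairing of `T_p M ⊕ T_p* M` with itself: twice the tautological inner product. -/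
def pairing (p : M) : GenTangent E p →ₗ[ℝ] Module.Dual ℝ (GenTangent E p) :=
  LinearMap.mk₂ ℝ (fun x y => x.2 y.1 + y.2 x.1)
    (fun x x' y => by simp; ring) (fun c x y => by simp; ring)
    (fun x y y' => by simp; ring) (fun c x y => by simp; ring)

theorem pairing_nondegenerate {p : M} {y : GenTangent E p} (h : ∀ x, pairing E p y x = 0) :
    y = 0 :=
  eq_zero_of_pairing_eq_zero fun z => h (z.toFun p)

theorem isSkewEndomorphism_aeval {φ : ∀ p : M, Module.End ℝ (GenTangent E p)}
    (hφ : IsSkewEndomorphism φ) {P q r : ℝ[X]} (hJ : IsJordanChevalleyPolynomial P q)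
    (hP : ∀ p, aeval (φ p) P = 0) (hr : r = q ∨ r = X - q) :
    IsSkewEndomorphism (fun p => aeval (φ p) r) where
  smooth := exists_genSection_aeval hφ.smooth r
  skew p x y := by
    have h := hJ.skew (β := pairing E p) (fun _ => pairing_nondegenerate) (fun x y => by
      have := hφ.skew p y x
      unfold tautInner at this
      change y.2 (φ p x).1 + (φ p x).2 y.1 + ((φ p y).2 x.1 + x.2 (φ p y).1) = 0
      linarith) (hP p) hr y x
    change x.2 (aeval (φ p) r y).1 + (aeval (φ p) r y).2 x.1 +
      ((aeval (φ p) r x).2 y.1 + y.2 (aeval (φ p) r x).1) = 0 at h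
    unfold tautInner
    linarith

/-- On a nonzero space all minimal polynomials have positive degree. -/
theorem natDegree_minpoly_pos {V : Type*} [AddCommGroup V] [Module ℝ V] [FiniteDimensional ℝ V]
    {f : Module.End ℝ V} (h : 0 < (minpoly ℝ f).natDegree) (g : Module.End ℝ V) :
    0 < (minpoly ℝ g).natDegree := by
  have : Nontrivial (Module.End ℝ V) := by
    by_contra hV
    rw [not_nontrivial_iff_subsingleton] at hV
    rw [minpoly.subsingleton, natDegree_one] at h
    exact lt_irrefl 0 h
  exact minpoly.natDegree_pos (Algebra.IsIntegral.isIntegral g)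

/-- The semisimple part `q(φ)` and the nilpotent part `φ - q(φ)` of a minimal structure `φ` are
minimal. The minimal polynomial of `r(φ)` at one point `p₀` is its minimal polynomial at every
point. -/
theorem IsMinimal.aeval_of_isJordanChevalleyPolynomial
    {φ : ∀ p : M, Module.End ℝ (GenTangent E p)} (hφ : IsMinimal φ) (p₀ : M) {q r : ℝ[X]}
    (hJ : IsJordanChevalleyPolynomial (minpoly ℝ (φ p₀)) q) (hr : r = q ∨ r = X - q) :
    IsMinimal (fun p => aeval (φ p) r) := by
  obtain ⟨P, hP, Φ, hΦ, htor⟩ := hφ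
  rw [hP.minpoly_eq] at hJ
  have hPφ : ∀ p, aeval (φ p) P = 0 := fun p => by
    rw [← hP.minpoly_eq p]; exact minpoly.aeval ℝ (φ p)
  have hskew := isSkewEndomorphism_aeval hP.toIsSkewEndomorphism hJ hPφ hr
  have hlift := isLift_liftOp hskew
  set Q := minpoly ℝ (aeval (φ p₀) r) with hQdef
  have hQ : P ∣ Q.comp r := by
    rw [← hP.minpoly_eq p₀]
    exact minpoly.dvd _ _ (by
      rw [aeval_comp]; exact minpoly.aeval ℝ (aeval (φ p₀) r))
  refine ⟨Q, ⟨hskew, minpoly.monic (Algebra.IsIntegral.isIntegral _),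
    natDegree_minpoly_pos (f := φ p₀) (by rw [hP.minpoly_eq]; exact hP.natDegree_pos) _,
    fun p => minpoly_aeval_eq ((hP.minpoly_eq p).trans (hP.minpoly_eq p₀).symm) r⟩,
    liftOp hskew, hlift, derivedBracket_eq_zero_of_torsion_eq_zero hskew ?_⟩
  rw [minimalOperator, ad_eq_innerDerivation hlift.even]
  refine torsion_aeval_eq_zero hJ hP.monic hr hQ (a := fieldEnd hP.smooth) ?_
    (commutator_cliffordSections hP.smooth hΦ) hΦ.commutator_torsion_deRham (fun x => ?_)
    hlift.commutator_torsion_deRham ?_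
  · refine LinearMap.ext fun s => Subtype.ext (funext fun p => ?_)
    exact (aeval_fieldEnd_apply hP.smooth P s p).trans (by rw [hPφ]; rfl)
  · rw [commutator_cliffordSections hskew.smooth hlift]
    refine congrArg _ (Subtype.ext (funext fun p => ?_))
    exact (aeval_fieldEnd_apply hP.smooth r x p).symm
  · refine Trilinear.ext fun x y z => ?_
    have h := htor (toGenSection x) (toGenSection y)
    rw [derivedBracket_of_odd (parityConj_minimalOperator hΦ.even P) (parityConj_clifford _),
      minimalOperator, ad_eq_innerDerivation hΦ.even] at h
    rw [torsion_eval]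
    refine (congrArg (fun u => u * cliffordSections z + cliffordSections z * u) h).trans ?_
    rw [zero_mul, mul_zero, add_zero]
    rfl

end Minimal

end GenGeom

end

theorem mainTheorem6 {E : Type*} [NormedAddCommGroup E] [NormedSpace ℝ E] [FiniteDimensional ℝ E]
    {M : Type*} [TopologicalSpace M] [T2Space M] [SecondCountableTopology M]
    [ChartedSpace E M] [IsManifold 𝓘(ℝ, E) ∞ M]
    (φ : ∀ p : M, Module.End ℝ (GenGeom.GenTangent E p)) (hφ : GenGeom.IsMinimal φ) :
    GenGeom.IsMinimal (fun p => GenGeom.semisimplePart (φ p)) ∧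
      GenGeom.IsMinimal (fun p => GenGeom.nilpotentPart (φ p)) := by
  rcases isEmpty_or_nonempty M with hM | ⟨⟨p₀⟩⟩
  · have h : ∀ ψ : ∀ p : M, Module.End ℝ (GenGeom.GenTangent E p), ψ = φ :=
      fun ψ => funext fun p => isEmptyElim p
    rw [h fun p => GenGeom.semisimplePart (φ p), h fun p => GenGeom.nilpotentPart (φ p)]
    exact ⟨hφ, hφ⟩
  obtain ⟨q, hq⟩ := GenGeom.exists_isJordanChevalleyPolynomial (φ p₀)
  obtain ⟨P, hP, -⟩ := id hφ
  have hs : ∀ p, GenGeom.semisimplePart (φ p) = Polynomial.aeval (φ p) q := fun p =>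
    hq.semisimplePart_eq (by
      rw [hP.minpoly_eq p₀, ← hP.minpoly_eq p]; exact minpoly.aeval ℝ (φ p))
  have hn : ∀ p, GenGeom.nilpotentPart (φ p) = Polynomial.aeval (φ p) (Polynomial.X - q) :=
    fun p => by rw [GenGeom.nilpotentPart, hs, map_sub, Polynomial.aeval_X]
  simp only [hs, hn]
  exact ⟨hφ.aeval_of_isJordanChevalleyPolynomial p₀ hq (Or.inl rfl),
    hφ.aeval_of_isJordanChevalleyPolynomial p₀ hq (Or.inr rfl)⟩
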